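/- For an integer $n\ge 1$, a (randomized) non-adaptive sampling algorithm on $n\times n$ real matrices draws a random seed, determines from the seed alone a set of positions in $[n]\times[n]$, reads the entries of the input at these positions, and outputs PSD or Not PSD as a function of the seed and of the entries read. For $\epsilon\in(0,1]$, such an algorithm solves PSD testing with $\epsilon$-$\ell_2^2$ gap with probability at least $2/3$ (with two-sided error) if for every symmetric $\mathbf A\in\mathbb R^{n\times n}$ with $\max_{i,j}|\mathbf A_{ij}|\le 1$: it outputs PSD with probability at least $2/3$ whenever $\mathbf A$ is positive semi-definite, and it outputs Not PSD with probability at least $2/3$ whenever $\mathbf A$ is $\epsilon$-far from PSD, i.e. $\min_{\mathbf B\succeq 0}\|\mathbf A-\mathbf B\|_F^2\ge\epsilon n^2$. For an integer $m\ge 3$ let $C_m$ denote the cycle on $m$ vertices (identified with its adjacency matrix), let $C_m\oplus C_{m+1}$ be the disjoint union of two cycles, let $\lambda=-2\cos\left(\frac{2\pi m}{2m+1}\right)$, and let $\mathbf J$ be the $r\times r$ all-ones matrix. For a matrix $\mathbf M$ indexed by a set $V$ and integers $k,r$ with $k|V|r\le n$, a random block instance of $\mathbf M$ is the $n\times n$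 matrix obtained by placing the block-diagonal matrix with $k$ diagonal blocks $\mathbf M\otimes\mathbf J$ at a uniformly random choice of $k|V|r$ distinct indices of $[n]$ (a uniformly random injection of $[k]\times V\times[r]$ into $[n]$), all other entries being $0$. Theorem. There are absolute constants $c>0$ and $p\in\mathbb N$ such that the following hold. (1) For all $n\ge 1$ and all $\epsilon\in(0,1]$, every non-adaptive sampling algorithm on $n\times n$ matrices that solves PSD testing with $\epsilon$-$\ell_2^2$ gap with probability at least $2/3$ queries, in expectation (hence also in the worst case), at least $$\frac{c\,\min\{n^2,\,1/\epsilon^2\}}{(1+\log(1/\epsilon))^p}$$ entries. In particular it makes $\tilde\Omega(1/\epsilon^2)$ queries whenever $n\ge 1/\epsilon$. (2) There are absolute constants $a,b,\epsilon_0>0$ such that for all $\epsilon\in(0,\epsilon_0)$ and all $n\ge 1/\epsilon$ there are integers $m\ge 3$, $k$ and $r$ with $a\log(1/\epsilon)\le m\le b\log(1/\epsilon)$ and $k(2m+1)r\le n$ for which: every block instance of $\frac12(C_{2m+1}+\lambda\mathbf I)$ is symmetric and positive semi-definite with entries bounded by $1$ in absolute value; every block instance of $\frac12(C_m\oplus C_{m+1}+\lambda\mathbf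 I)$ is symmetric and $\epsilon$-far from PSD with entries bounded by $1$ in absolute value; and every non-adaptive sampling algorithm which, given one of these two random block instances chosen by a fair coin, tells with probability at least $2/3$ which of the two it was drawn from, queries in expectation at least $c\,\epsilon^{-2}/(1+\log(1/\epsilon))^p$ entries. -/

import Mathlib

open Matrix MeasureTheory
open scoped Kronecker

universe u

/-- All entries of the matrix have absolute value at most `1` (the bounded entry model). -/
def EntryBounded {n : ℕ} (A : Matrix (Fin n) (Fin n) ℝ) : Prop :=
  ∀ i j, |A i j| ≤ 1

/-- `A` is `ε`-far from the cone of positive semi-definite matrices in squared Frobenius norm: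
`min_{B ⪰ 0} ‖A - B‖_F² ≥ ε n²`. -/
def FarFromPSD {n : ℕ} (ε : ℝ) (A : Matrix (Fin n) (Fin n) ℝ) : Prop :=
  ∀ B : Matrix (Fin n) (Fin n) ℝ, B.PosSemidef →
    ε * (n : ℝ) ^ 2 ≤ ∑ i, ∑ j, (A i j - B i j) ^ 2

/-- A (randomized) non-adaptive sampling algorithm for `n × n` matrices. The random seed `ω` is
drawn from a probability space; it determines the set of positions that are queried, before any
entry is seen. The answer (`true` for "PSD", `false` for "not PSD") is an arbitrary function of the
seed and of the values of the queried entries. -/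
structure NonadaptiveAlgorithm (n : ℕ) where
  /-- the space of random seeds -/
  Ω : Type u
  /-- its sigma-algebra -/
  [mΩ : MeasurableSpace Ω]
  /-- the law of the seed -/
  μ : Measure Ω
  [prob : IsProbabilityMeasure μ]
  /-- the set of queried positions -/
  query : Ω → Finset (Fin n × Fin n)
  /-- the answer on a given input matrix -/
  output : Ω → Matrix (Fin n) (Fin n) ℝ → Bool
  /-- the answer depends on the input only through the queried entries -/
  output_congr : ∀ (ω : Ω) (A B : Matrix (Fin n) (Fin n) ℝ),
    (∀ q ∈ query ω, A q.1 q.2 = B q.1 q.2) → output ω A = output ω B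
  measurable_query : ∀ S : Finset (Fin n × Fin n), MeasurableSet {ω | query ω = S}
  measurable_output : ∀ A : Matrix (Fin n) (Fin n) ℝ, MeasurableSet {ω | output ω A = true}

attribute [instance] NonadaptiveAlgorithm.mΩ NonadaptiveAlgorithm.prob

namespace NonadaptiveAlgorithm

variable {n : ℕ}

/-- The probability that the algorithm gives the answer `b` on input `A`. -/
noncomputable def answerProb (T : NonadaptiveAlgorithm.{u} n) (A : Matrix (Fin n) (Fin n) ℝ)
    (b : Bool) : ℝ :=
  T.μ.real {ω | T.output ω A = b}

/-- The expected number of queried entries. -/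
noncomputable def expectedQueries (T : NonadaptiveAlgorithm.{u} n) : ℝ :=
  ∫ ω, ((T.query ω).card : ℝ) ∂T.μ

/-- The algorithm solves the PSD testing problem with `ε`-`ℓ₂²` gap with probability at least `2/3`
(with two-sided error): on every symmetric `A` with entries bounded by `1`, it answers "PSD" with
probability at least `2/3` if `A` is PSD, and "not PSD" with probability at least `2/3` if `A` is
`ε`-far from PSD. -/
def SolvesPSDTesting (T : NonadaptiveAlgorithm.{u} n) (ε : ℝ) : Prop :=
  ∀ A : Matrix (Fin n) (Fin n) ℝ, A.IsSymm → EntryBounded A →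
    (A.PosSemidef → 2 / 3 ≤ T.answerProb A true) ∧
    (FarFromPSD ε A → 2 / 3 ≤ T.answerProb A false)

/-- Given two finite families of matrices, the algorithm tells a uniformly random member of the
first family (answer `true`) from a uniformly random member of the second one (answer `false`) with
probability at least `2/3`, when a fair coin decides from which family the input is drawn. -/
def Distinguishes (T : NonadaptiveAlgorithm.{u} n) {ι κ : Type} [Fintype ι] [Fintype κ]
    (D₁ : ι → Matrix (Fin n) (Fin n) ℝ) (D₂ : κ → Matrix (Fin n) (Fin n) ℝ) : Prop :=
  2 / 3 ≤ (1 / 2 : ℝ) * ((∑ x, T.answerProb (D₁ x) true) / Fintype.card ι)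
    + (1 / 2 : ℝ) * ((∑ y, T.answerProb (D₂ y) false) / Fintype.card κ)

end NonadaptiveAlgorithm

/-- The shift `λ = -2 cos (2 π m / (2 m + 1))`, minus the least eigenvalue of the cycle of length
`2 m + 1`. -/
noncomputable def cycleShift (m : ℕ) : ℝ :=
  -2 * Real.cos (2 * Real.pi * m / (2 * m + 1))

/-- `(1/2) (A(C_{2m+1}) + λ I)`. -/
noncomputable def longCycleMatrix (m : ℕ) : Matrix (Fin (2 * m + 1)) (Fin (2 * m + 1)) ℝ :=
  (1 / 2 : ℝ) • ((SimpleGraph.cycleGraph (2 * m + 1)).adjMatrix ℝ + cycleShift m • 1)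

/-- `(1/2) (A(C_m ⊕ C_{m+1}) + λ I)`, with the same `λ`. -/
noncomputable def twoCyclesMatrix (m : ℕ) :
    Matrix (Fin m ⊕ Fin (m + 1)) (Fin m ⊕ Fin (m + 1)) ℝ :=
  (1 / 2 : ℝ) • (Matrix.fromBlocks ((SimpleGraph.cycleGraph m).adjMatrix ℝ) 0
    0 ((SimpleGraph.cycleGraph (m + 1)).adjMatrix ℝ) + cycleShift m • 1)

/-- The ways to place `k` disjoint labelled copies of `V × [r]` inside `[n]`. A uniformly random
placement chooses the `k` blocks, and the arrangement of the indices inside them, at random. -/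
abbrev Placement (k r n : ℕ) (V : Type) : Type := Fin k × (V × Fin r) ↪ Fin n

/-- The `n × n` matrix with `k` diagonal blocks, each a copy of `M ⊗ J` (`J` the `r × r` all-ones
matrix), at the positions given by the placement `e`, and zeros elsewhere. -/
noncomputable def blockInstance {k r n : ℕ} {V : Type} [Fintype V] (M : Matrix V V ℝ)
    (e : Placement k r n V) : Matrix (Fin n) (Fin n) ℝ :=
  Matrix.of fun p q => ∑ x : Fin k × (V × Fin r), ∑ y : Fin k × (V × Fin r),
    if e x = p ∧ e y = q then
      ((1 : Matrix (Fin k) (Fin k) ℝ) ⊗ₖ (M ⊗ₖ (Matrix.of fun _ _ => 1 : Matrix (Fin r) (Fin r) ℝ)))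
        x y
    else 0

/-!
The two families of hard instances look alike locally. Write the vertices of `C_m` and `C_{m+1}` as
two parallel strands with columns `0, 1, …`. Joined end to end the strands form `C_{2m+1}`, and
exchanging them in the columns `0, …, j` turns `C_{2m+1}` into `C_m ⊕ C_{m+1}`: the only pairs of
vertices whose adjacency changes lie in the columns `j` and `j + 1`
(`longCycleMatrix_strandEquiv`).

Fix a set `Q` of queried positions and a placement of the long cycles, and look at the positions
from `Q` inside of one block. If they have a vertex cover by fewer than about `m / 2` indices, then
some two consecutive columns contain no index from the cover, and the surgery at the first such
pair of columns is invisible on `Q`. The cover is chosen as a function of the set of indices of the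
block alone, and the exchange of the strands preserves both this set and the column of every
index. Therefore the surgery can be undone by the same rule: it is an involution, and so maps the
uniform distribution on placements to itself (`surgery`). It couples the two random instances such
that they agree on `Q` whenever all blocks have small covers (`blockInstance_surgery`).

A block without a cover by `2 s` indices contains `s` pairwise disjoint positions from `Q`
(`exists_matching_or_cover`). As a block is filled by a random set of at most `n / k` indices, a
union bound shows that this occurs in some block with probability at most `k (|Q| / k²) ^ s`
(`card_embedding_with_matching_le`). For `|Q| ≤ k² / 9` and `s` of order `log k` the probability is
at most `1 / 6`, and hence distinguishing the instances takes at least `k² / 54` expected queries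
(`sq_div_le_expectedQueries`).

The shift `λ` makes the long cycle positive semi-definite, by Fourier analysis
(`half_adj_add_shift_posSemidef`). The alternating vector on the even one of the short cycles gives
the eigenvalue `-(2 - λ) / 2 ≤ -2 / (2m+1)²`, so that the distance of `k` blocks with
multiplicity `r` from the semi-definite cone is at least `k (2 r / (2m+1)²)²`
(`farFromPSD_blockInstance`). With `m` of order `log (1 / ε)` one may take `k` of order
`1 / (ε (2m+1)⁶)` (`exists_hard_block_instances`). In the range `n < 1 / ε` the lower bound for
testing follows from the case of the larger gap `1 / n`, and for gaps bounded from below it only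
says that some entry has to be queried.
-/

/-! ### Entries of block instances -/

theorem blockInstance_apply_apply {k r n : ℕ} {V : Type} [Fintype V] (M : Matrix V V ℝ)
    (e : Placement k r n V) (x y : Fin k × (V × Fin r)) :
    blockInstance M e (e x) (e y) = if x.1 = y.1 then M x.2.1 y.2.1 else 0 := by
  classical
  simp only [blockInstance, of_apply, EmbeddingLike.apply_eq_iff_eq]
  rw [Finset.sum_eq_single x, Finset.sum_eq_single y]
  · simp [kroneckerMap_apply, one_apply]
  · rintro b - hb
    simp [hb]
  · simp
  · rintro b - hb
    simp [hb]
  · simp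

theorem blockInstance_eq_zero {k r n : ℕ} {V : Type} [Fintype V] (M : Matrix V V ℝ)
    (e : Placement k r n V) {p q : Fin n} (h : ¬ ((∃ x, e x = p) ∧ ∃ y, e y = q)) :
    blockInstance M e p q = 0 := by
  simp only [blockInstance, of_apply]
  refine Finset.sum_eq_zero fun x _ => Finset.sum_eq_zero fun y _ => if_neg ?_
  rintro ⟨hx, hy⟩
  exact h ⟨⟨x, hx⟩, ⟨y, hy⟩⟩

theorem blockInstance_cases {k r n : ℕ} {V : Type} [Fintype V] (M : Matrix V V ℝ)
    (e : Placement k r n V) (p q : Fin n) :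
    blockInstance M e p q = 0 ∨ ∃ v w, blockInstance M e p q = M v w := by
  by_cases h : (∃ x, e x = p) ∧ ∃ y, e y = q
  · obtain ⟨⟨x, rfl⟩, ⟨y, rfl⟩⟩ := h
    rw [blockInstance_apply_apply]
    split_ifs
    · exact Or.inr ⟨_, _, rfl⟩
    · exact Or.inl rfl
  · exact Or.inl (blockInstance_eq_zero M e h)

theorem blockInstance_isSymm {k r n : ℕ} {V : Type} [Fintype V] {M : Matrix V V ℝ}
    (hM : M.IsSymm) (e : Placement k r n V) : (blockInstance M e).IsSymm := by
  ext p q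
  rw [transpose_apply]
  by_cases h : (∃ x, e x = p) ∧ ∃ y, e y = q
  · obtain ⟨⟨x, rfl⟩, ⟨y, rfl⟩⟩ := h
    rw [blockInstance_apply_apply, blockInstance_apply_apply, hM.apply]
    simp only [eq_comm]
  · rw [blockInstance_eq_zero M e h, blockInstance_eq_zero M e fun h' => h h'.symm]

theorem blockInstance_entryBounded {k r n : ℕ} {V : Type} [Fintype V] {M : Matrix V V ℝ}
    (hM : ∀ v w, |M v w| ≤ 1) (e : Placement k r n V) : EntryBounded (blockInstance M e) := by
  intro p q
  rcases blockInstance_cases M e p q with h | ⟨v, w, h⟩ <;> rw [h]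
  · simp
  · exact hM v w

theorem blockInstance_posSemidef {k r n : ℕ} {V : Type} [Fintype V] {M : Matrix V V ℝ}
    (hM : M.PosSemidef) (e : Placement k r n V) : (blockInstance M e).PosSemidef := by
  classical
  have hJ : (Matrix.of fun _ _ => 1 : Matrix (Fin r) (Fin r) ℝ).PosSemidef := by
    have := posSemidef_vecMulVec_self_star (R := ℝ) (fun _ : Fin r => (1 : ℝ))
    convert this using 1
    ext i j
    simp [vecMulVec_apply]
  have hK := ((PosSemidef.one (n := Fin k) (R := ℝ)).kronecker
    (hM.kronecker hJ)).mul_mul_conjTranspose_same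
      (Matrix.of fun p x => if e x = p then (1 : ℝ) else 0 : Matrix (Fin n) _ ℝ)
  refine (congrArg PosSemidef ?_).mpr hK
  ext p q
  simp only [blockInstance, of_apply, mul_apply, Finset.sum_mul, conjTranspose_apply]
  rw [Finset.sum_comm]
  refine Finset.sum_congr rfl fun x _ => Finset.sum_congr rfl fun y _ => ?_
  by_cases h1 : e y = p <;> by_cases h2 : e x = q <;> simp [h1, h2]

/-! ### Matchings and vertex covers -/

/-- The endpoint of a pair selected by a Boolean. -/
def endpoint {α : Type*} (q : α × α) (b : Bool) : α := bif b then q.2 else q.1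

/-- A greedy argument: a set of pairs of distinct points contains `s` pairwise disjoint pairs, or
it is covered by `2 s` points. -/
theorem exists_matching_or_cover {α : Type*} (E : Set (α × α))
    (hE : ∀ q ∈ E, q.1 ≠ q.2) (s : ℕ) :
    (∃ f : Fin s → α × α, (∀ a, f a ∈ E) ∧
      Function.Injective fun d : Fin s × Bool => endpoint (f d.1) d.2) ∨
    ∃ S : Finset α, S.card ≤ 2 * s ∧ ∀ q ∈ E, q.1 ∈ S ∨ q.2 ∈ S := by
  classical
  induction s with
  | zero => exact Or.inl ⟨Fin.elim0, fun a => a.elim0, fun d => d.1.elim0⟩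
  | succ s ih =>
    rcases ih with ⟨f, hf, hinj⟩ | ⟨S, hS, hcov⟩
    · set S : Finset α := Finset.univ.image fun d : Fin s × Bool => endpoint (f d.1) d.2 with hSdef
      by_cases hcov : ∀ q ∈ E, q.1 ∈ S ∨ q.2 ∈ S
      · refine Or.inr ⟨S, ?_, hcov⟩
        refine Finset.card_image_le.trans ?_
        simp
        omega
      · push Not at hcov
        obtain ⟨q, hq, hq1, hq2⟩ := hcov
        refine Or.inl ⟨Fin.cons q f, fun a => ?_, ?_⟩
        · refine Fin.cases ?_ (fun a => ?_) a
          · simpa using hq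
          · simpa using hf a
        · have hout : ∀ b d c, endpoint q b ≠ endpoint (f d) c := by
            intro b d c hh
            have : endpoint q b ∈ S := by
              rw [hh, hSdef]
              exact Finset.mem_image_of_mem (fun d : Fin s × Bool => endpoint (f d.1) d.2)
                (Finset.mem_univ (d, c))
            cases b
            · exact hq1 this
            · exact hq2 this
          rintro ⟨a, b⟩ ⟨a', b'⟩ h
          induction a using Fin.cases with
          | zero =>
            induction a' using Fin.cases with
            | zero =>
              have hne := hE q hq
              cases b <;> cases b' <;> simp [endpoint, hne, hne.symm] at h ⊢
            | succ a' => exact absurd h (by simpa using hout b a' b')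
          | succ a =>
            induction a' using Fin.cases with
            | zero => exact absurd h (by simpa using (hout b' a b).symm)
            | succ a' =>
              have := @hinj (a, b) (a', b') (by simpa using h)
              simpa using this
    · exact Or.inr ⟨S, hS.trans (by omega), hcov⟩

/-! ### Random embeddings -/

/-- A uniformly random embedding takes prescribed values at `d` given points with probability at
most `1 / (N (N - 1) ⋯ (N - d + 1))`. -/
theorem card_embedding_extending_mul_le {D X β : Type*} [Fintype D] [Fintype X] [Fintype β]
    [DecidableEq D] [DecidableEq X] [DecidableEq β] (y : D ↪ X) (x : D → β) :
    (Finset.univ.filter fun e : X ↪ β => ∀ d, e (y d) = x d).card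
      * (Fintype.card β).descFactorial (Fintype.card D) ≤ Fintype.card (X ↪ β) := by
  by_cases hx : Function.Injective x
  · -- by symmetry all the prescriptions `x'` are equally likely, and their events are disjoint
    have hconst : ∀ x' : D ↪ β, (Finset.univ.filter fun e : X ↪ β => y.trans e = x').card
        = (Finset.univ.filter fun e : X ↪ β => ∀ d, e (y d) = x d).card := by
      intro x'
      obtain ⟨σ, hσ⟩ := Equiv.Perm.exists_extending_pair x x' hx x'.injective
      refine Finset.card_bij' (fun e _ => e.trans σ.symm.toEmbedding)
        (fun e _ => e.trans σ.toEmbedding) ?_ ?_ ?_ ?_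
      · intro e he
        simp only [Finset.mem_filter, Finset.mem_univ, true_and] at he ⊢
        intro d
        have := congrArg (fun g : D ↪ β => g d) he
        simp only [Function.Embedding.trans_apply] at this
        simp [this, ← hσ]
      · intro e he
        simp only [Finset.mem_filter, Finset.mem_univ, true_and] at he ⊢
        ext d
        simp [he, hσ]
      · intro e _
        ext a
        simp
      · intro e _
        ext a
        simp
    have hsum := Finset.card_eq_sum_card_fiberwise (s := (Finset.univ : Finset (X ↪ β)))
      (t := (Finset.univ : Finset (D ↪ β))) (f := fun e => y.trans e) (by simp [Set.MapsTo])
    simp only [hconst, Finset.sum_const, Finset.card_univ, 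
      smul_eq_mul, Fintype.card_embedding_eq (α := D)] at hsum
    rw [hsum, mul_comm]
  · rw [Finset.filter_false_of_mem]
    · simp
    · intro e _ he
      refine hx fun a b hab => ?_
      exact y.injective (e.injective (by rw [he, he, hab]))

theorem descFactorial_mul_pow_le {a b : ℕ} (hab : a ≤ b) (d : ℕ) :
    a.descFactorial d * b ^ d ≤ b.descFactorial d * a ^ d := by
  induction d with
  | zero => simp
  | succ d ih =>
    rw [Nat.descFactorial_succ, Nat.descFactorial_succ, pow_succ, pow_succ]
    have h : (a - d) * b ≤ (b - d) * a := by
      rcases le_total a d with had | had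
      · simp [Nat.sub_eq_zero_of_le had]
      · obtain ⟨a, rfl⟩ := Nat.exists_eq_add_of_le had
        obtain ⟨b, rfl⟩ := Nat.exists_eq_add_of_le hab
        have h1 : d + a - d = a := by omega
        have h2 : d + a + b - d = a + b := by omega
        rw [h1, h2]
        nlinarith [Nat.zero_le (d * b)]
    calc (a - d) * a.descFactorial d * (b ^ d * b)
        = ((a - d) * b) * (a.descFactorial d * b ^ d) := by ring
      _ ≤ ((b - d) * a) * (b.descFactorial d * a ^ d) := Nat.mul_le_mul h ih
      _ = _ := by ring

/-- The first moment bound: if `|K|` disjoint blocks of `|C|` points are placed at random among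
`|β|` points, the probability that some block contains `s` disjoint pairs from `Q` is at most
`|K| (|Q| |C|² / |β|²) ^ s`. -/
theorem card_embedding_with_matching_le {K C β : Type*} [Fintype K] [Fintype C] [Fintype β]
    [DecidableEq K] [DecidableEq C] [DecidableEq β] (hCβ : Fintype.card C ≤ Fintype.card β)
    (Q : Finset (β × β)) (s : ℕ) (B : Finset (K × C ↪ β))
    (hB : ∀ e ∈ B, ∃ i, ∃ f : Fin s → β × β, (∀ a, f a ∈ Q) ∧
      (Function.Injective fun d : Fin s × Bool => endpoint (f d.1) d.2) ∧
      ∀ d : Fin s × Bool, ∃ c, e (i, c) = endpoint (f d.1) d.2) :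
    B.card * Fintype.card β ^ (2 * s) ≤
      Fintype.card K * Q.card ^ s * Fintype.card C ^ (2 * s) * Fintype.card (K × C ↪ β) := by
  classical
  set d := 2 * s with hd
  have hD : Fintype.card (Fin s × Bool) = d := by simp [hd, mul_comm]
  set T : K → (Fin s → β × β) → ((Fin s × Bool) ↪ C) → Finset (K × C ↪ β) := fun i f y =>
    Finset.univ.filter fun e => ∀ a, e (i, y a) = endpoint (f a.1) a.2 with hT
  -- the union bound, over the block, the matching and the positions of its endpoints in the block
  have hsub : B ⊆ Finset.univ.biUnion fun i : K =>
      (Fintype.piFinset fun _ : Fin s => Q).biUnion fun f =>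
        Finset.univ.biUnion fun y => T i f y := by
    intro e he
    obtain ⟨i, f, hf, hinj, hc⟩ := hB e he
    choose y hy using hc
    have hyinj : Function.Injective y := by
      intro a b hab
      apply hinj
      simp only [← hy, hab]
    simp only [Finset.mem_biUnion, Finset.mem_univ, true_and, Fintype.mem_piFinset]
    exact ⟨i, f, hf, ⟨y, hyinj⟩, by simpa [hT] using fun a b => hy (a, b)⟩
  have hTcard : ∀ i f y, (T i f y).card * (Fintype.card β).descFactorial d
      ≤ Fintype.card (K × C ↪ β) := by
    intro i f y
    have := card_embedding_extending_mul_le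
      (y.trans ⟨fun c => (i, c), Prod.mk_right_injective i⟩) fun a => endpoint (f a.1) a.2
    rw [hD] at this
    simpa [hT] using this
  -- if `β` has fewer than `2 s` points, it does not contain `s` disjoint pairs
  rcases Nat.eq_zero_or_pos ((Fintype.card β).descFactorial d) with h0 | hpos
  · have hC0 : (Fintype.card C).descFactorial d = 0 := by
      rw [Nat.descFactorial_eq_zero_iff_lt] at h0 ⊢
      omega
    have : IsEmpty ((Fin s × Bool) ↪ C) := by
      rw [← Fintype.card_eq_zero_iff, Fintype.card_embedding_eq, hD, hC0]
    have hB0 : B = ∅ := by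
      refine Finset.eq_empty_of_forall_notMem fun e he => ?_
      simpa using hsub he
    simp [hB0]
  have hcard : B.card * (Fintype.card β).descFactorial d ≤ Fintype.card K *
      (Q.card ^ s * ((Fintype.card C).descFactorial d * Fintype.card (K × C ↪ β))) := by
    refine (Nat.mul_le_mul_right _ ((Finset.card_le_card hsub).trans
      Finset.card_biUnion_le)).trans ?_
    rw [Finset.sum_mul]
    refine (Finset.sum_le_card_nsmul _ _ _ fun i _ => ?_).trans_eq
      (by rw [smul_eq_mul, Finset.card_univ])
    refine (Nat.mul_le_mul_right _ Finset.card_biUnion_le).trans ?_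
    rw [Finset.sum_mul]
    refine (Finset.sum_le_card_nsmul _ _ _ fun f _ => ?_).trans_eq
      (by rw [smul_eq_mul, Fintype.card_piFinset_const])
    refine (Nat.mul_le_mul_right _ Finset.card_biUnion_le).trans ?_
    rw [Finset.sum_mul]
    refine (Finset.sum_le_card_nsmul _ _ _ fun y _ => hTcard i f y).trans_eq ?_
    rw [smul_eq_mul, Finset.card_univ, Fintype.card_embedding_eq, hD]
  refine Nat.le_of_mul_le_mul_right ?_ hpos
  calc B.card * Fintype.card β ^ d * (Fintype.card β).descFactorial d
      = (B.card * (Fintype.card β).descFactorial d) * Fintype.card β ^ d := by ring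
    _ ≤ (Fintype.card K * (Q.card ^ s * ((Fintype.card C).descFactorial d *
        Fintype.card (K × C ↪ β)))) * Fintype.card β ^ d := Nat.mul_le_mul_right _ hcard
    _ = (Fintype.card K * Q.card ^ s * Fintype.card (K × C ↪ β)) *
        ((Fintype.card C).descFactorial d * Fintype.card β ^ d) := by ring
    _ ≤ (Fintype.card K * Q.card ^ s * Fintype.card (K × C ↪ β)) *
        ((Fintype.card β).descFactorial d * Fintype.card C ^ d) :=
      Nat.mul_le_mul_left _ (descFactorial_mul_pow_le hCβ d)
    _ = _ := by ring

/-! ### Surgery on cycles -/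

theorem cycleGraph_adj_iff_val {N : ℕ} (hN : 3 ≤ N) (a b : Fin N) :
    (SimpleGraph.cycleGraph N).Adj a b ↔
      a.val + 1 = b.val ∨ b.val + 1 = a.val ∨ (a.val = 0 ∧ b.val + 1 = N) ∨
        (b.val = 0 ∧ a.val + 1 = N) := by
  rw [SimpleGraph.cycleGraph_adj']
  have ha := a.isLt
  have hb := b.isLt
  rcases lt_trichotomy a b with h | h | h
  · have h1 := Fin.coe_sub_iff_lt.2 h
    have h2 := Fin.sub_val_of_le h.le
    rw [h1, h2]
    have : a.val < b.val := h
    omega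
  · subst h
    have h2 := Fin.sub_val_of_le (le_refl a)
    rw [h2]
    omega
  · have h1 := Fin.coe_sub_iff_lt.2 h
    have h2 := Fin.sub_val_of_le h.le
    rw [h1, h2]
    have : b.val < a.val := h
    omega

/-- The column of a vertex when the cycles `C_m` and `C_{m+1}` are written as two parallel
strands; the last vertex of `C_{m+1}` is alone in the column `m`. -/
def strandColumn {m : ℕ} : Fin m ⊕ Fin (m + 1) → ℕ :=
  Sum.elim Fin.val Fin.val

/-- The underlying map of `strandSwap`. -/
def strandSwapFun (m j : ℕ) : Fin m ⊕ Fin (m + 1) → Fin m ⊕ Fin (m + 1)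
  | .inl i => if i.val ≤ j then .inr i.castSucc else .inl i
  | .inr i => if h : i.val ≤ j ∧ i.val < m then .inl ⟨i.val, h.2⟩ else .inr i

theorem strandSwapFun_involutive (m j : ℕ) : Function.Involutive (strandSwapFun m j) := by
  rintro (i | i)
  · by_cases h : i.val ≤ j
    · simp [strandSwapFun, h]
    · simp [strandSwapFun, h]
  · by_cases h : i.val ≤ j ∧ i.val < m
    · simp [strandSwapFun, h]
    · simp [strandSwapFun, h]

/-- The permutation which exchanges the two strands in the columns `0, …, j` (as far as
these have two vertices). -/
def strandSwap (m j : ℕ) : Equiv.Perm (Fin m ⊕ Fin (m + 1)) :=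
  (strandSwapFun_involutive m j).toPerm

theorem strandSwap_strandSwap (m j : ℕ) (x : Fin m ⊕ Fin (m + 1)) :
    strandSwap m j (strandSwap m j x) = x :=
  strandSwapFun_involutive m j x

theorem strandColumn_strandSwap (m j : ℕ) (x : Fin m ⊕ Fin (m + 1)) :
    strandColumn (strandSwap m j x) = strandColumn x := by
  rcases x with i | i
  · by_cases h : i.val ≤ j <;> simp [strandSwap, strandSwapFun, strandColumn, h]
  · by_cases h : i.val ≤ j ∧ i.val < m <;> simp [strandSwap, strandSwapFun, strandColumn, h]

/-- The two strands joined end to end, as the vertices of the cycle of length `2 m + 1`. -/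
def strandEquiv (m : ℕ) : Fin m ⊕ Fin (m + 1) ≃ Fin (2 * m + 1) :=
  finSumFinEquiv.trans (finCongr (by omega))

theorem strandEquiv_inl_val (m : ℕ) (i : Fin m) : (strandEquiv m (.inl i)).val = i.val := by
  simp [strandEquiv]

theorem strandEquiv_inr_val (m : ℕ) (i : Fin (m + 1)) :
    (strandEquiv m (.inr i)).val = m + i.val := by
  simp [strandEquiv]

theorem twoCyclesMatrix_inl_inl {m : ℕ} (i j : Fin m) : twoCyclesMatrix m (.inl i) (.inl j) =
    (1 / 2) * ((if (SimpleGraph.cycleGraph m).Adj i j then 1 else 0)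
      + cycleShift m * if i = j then 1 else 0) := by
  simp [twoCyclesMatrix, SimpleGraph.adjMatrix_apply, one_apply]

theorem twoCyclesMatrix_inr_inr {m : ℕ} (i j : Fin (m + 1)) :
    twoCyclesMatrix m (.inr i) (.inr j) =
    (1 / 2) * ((if (SimpleGraph.cycleGraph (m + 1)).Adj i j then 1 else 0)
      + cycleShift m * if i = j then 1 else 0) := by
  simp [twoCyclesMatrix, SimpleGraph.adjMatrix_apply, one_apply]

theorem twoCyclesMatrix_inl_inr {m : ℕ} (i : Fin m) (j : Fin (m + 1)) :
    twoCyclesMatrix m (.inl i) (.inr j) = 0 := by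
  simp [twoCyclesMatrix]

theorem twoCyclesMatrix_inr_inl {m : ℕ} (i : Fin m) (j : Fin (m + 1)) :
    twoCyclesMatrix m (.inr j) (.inl i) = 0 := by
  simp [twoCyclesMatrix]

theorem longCycleMatrix_apply {m : ℕ} (i j : Fin (2 * m + 1)) : longCycleMatrix m i j =
    (1 / 2) * ((if (SimpleGraph.cycleGraph (2 * m + 1)).Adj i j then 1 else 0)
      + cycleShift m * if i = j then 1 else 0) := by
  simp [longCycleMatrix, SimpleGraph.adjMatrix_apply, one_apply]

/-- Exchanging the strands up to column `j` cuts the cycle of length `2 m + 1` between the columns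
`j` and `j + 1` and closes the pieces up to cycles of lengths `m` and `m + 1`. Only the pairs
inside of these two columns can tell the difference. -/
theorem longCycleMatrix_strandEquiv {m j : ℕ} (hm : 3 ≤ m) (hj : j + 1 < m)
    (x y : Fin m ⊕ Fin (m + 1))
    (hxy : x = y ∨ (strandColumn x ≠ j ∧ strandColumn x ≠ j + 1) ∨
      (strandColumn y ≠ j ∧ strandColumn y ≠ j + 1)) :
    longCycleMatrix m (strandEquiv m x) (strandEquiv m y) =
      twoCyclesMatrix m (strandSwap m j x) (strandSwap m j y) := by
  have hm1 : 3 ≤ m + 1 := by omega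
  have hm2 : 3 ≤ 2 * m + 1 := by omega
  -- both sides are compared as truth values of adjacency and equality, in each case of the strands
  have key : ∀ {P P' R R' : Prop} [Decidable P] [Decidable P'] [Decidable R] [Decidable R'],
      (P ↔ P') → (R ↔ R') → (1 / 2 : ℝ) * ((if P then 1 else 0) + cycleShift m * if R then 1 else 0)
        = (1 / 2) * ((if P' then 1 else 0) + cycleShift m * if R' then 1 else 0) := by
    intro P P' R R' _ _ _ _ h1 h2
    simp only [h1, h2]
  have key0 : ∀ {P R : Prop} [Decidable P] [Decidable R], ¬ P → ¬ R →
      (1 / 2 : ℝ) * ((if P then 1 else 0) + cycleShift m * if R then 1 else 0) = 0 := by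
    intro P R _ _ h1 h2
    simp [h1, h2]
  rcases x with a | a <;> rcases y with b | b <;>
    simp only [strandSwap, Function.Involutive.coe_toPerm, strandSwapFun] <;>
    split_ifs <;>
    simp only [longCycleMatrix_apply, twoCyclesMatrix_inl_inl, twoCyclesMatrix_inl_inr,
      twoCyclesMatrix_inr_inl, twoCyclesMatrix_inr_inr] <;>
    (first | apply key | apply key0) <;>
    simp only [cycleGraph_adj_iff_val hm, cycleGraph_adj_iff_val hm1, cycleGraph_adj_iff_val hm2,
      Fin.ext_iff, strandEquiv_inl_val, strandEquiv_inr_val, Fin.val_castSucc,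
      strandColumn, Sum.elim_inl, Sum.elim_inr, reduceCtorEq, false_or, Sum.inl.injEq,
      Sum.inr.injEq] at hxy ⊢ <;>
    omega

/-! ### The coupling of the two random block instances -/

/-- The set of indices occupied by a block. -/
def blockSupport {k r n : ℕ} {V : Type} (e : Placement k r n V) (i : Fin k) : Set (Fin n) :=
  Set.range fun c => e (i, c)

/-- `S` meets every off-diagonal position from `Q` inside of `B × B`. -/
def CoversWithin {n : ℕ} (Q : Finset (Fin n × Fin n)) (B : Set (Fin n)) (S : Finset (Fin n)) :
    Prop :=
  ∀ q ∈ Q, q.1 ≠ q.2 → q.1 ∈ B → q.2 ∈ B → q.1 ∈ S ∨ q.2 ∈ S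

/-- A cover of the positions from `Q` inside of `B × B` by at most `t` indices, chosen as a function
of `B` alone; an arbitrary set if there is no such cover. -/
noncomputable def smallCover {n : ℕ} (Q : Finset (Fin n × Fin n)) (t : ℕ) (B : Set (Fin n)) :
    Finset (Fin n) :=
  Classical.epsilon fun S => S.card ≤ t ∧ CoversWithin Q B S

/-- The columns `j` such that no index from the small cover of the block `i` sits in the columns `j`
and `j + 1`. -/
def freeColumns {k r n m : ℕ} (Q : Finset (Fin n × Fin n)) (t : ℕ)
    (e : Placement k r n (Fin m ⊕ Fin (m + 1))) (i : Fin k) : Set ℕ :=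
  {j | j + 1 < m ∧ ∀ w l, e (i, (w, l)) ∈ smallCover Q t (blockSupport e i) →
    strandColumn w ≠ j ∧ strandColumn w ≠ j + 1}

/-- Exchange the strands of each block `i` in the columns `0, …, j i`. -/
def swapPlacement {k r n m : ℕ} (j : Fin k → ℕ) (e : Placement k r n (Fin m ⊕ Fin (m + 1))) :
    Placement k r n (Fin m ⊕ Fin (m + 1)) where
  toFun x := e (x.1, (strandSwap m (j x.1) x.2.1, x.2.2))
  inj' := by
    rintro ⟨i, w, l⟩ ⟨i', w', l'⟩ h
    have h := e.injective h
    simp only [Prod.mk.injEq] at h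
    obtain ⟨rfl, h, rfl⟩ := h
    simpa using h

section Swap

variable {k r n m : ℕ} (j : Fin k → ℕ) (e : Placement k r n (Fin m ⊕ Fin (m + 1)))

theorem swapPlacement_apply (i : Fin k) (w : Fin m ⊕ Fin (m + 1)) (l : Fin r) :
    swapPlacement j e (i, (w, l)) = e (i, (strandSwap m (j i) w, l)) := rfl

theorem swapPlacement_apply_strandSwap (i : Fin k) (w : Fin m ⊕ Fin (m + 1)) (l : Fin r) :
    swapPlacement j e (i, (strandSwap m (j i) w, l)) = e (i, (w, l)) := by
  rw [swapPlacement_apply, strandSwap_strandSwap]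

theorem swapPlacement_swapPlacement : swapPlacement j (swapPlacement j e) = e := by
  ext ⟨i, w, l⟩
  rw [swapPlacement_apply, swapPlacement_apply_strandSwap]

theorem blockSupport_swapPlacement (i : Fin k) :
    blockSupport (swapPlacement j e) i = blockSupport e i := by
  apply Set.Subset.antisymm
  · rintro _ ⟨⟨w, l⟩, rfl⟩
    exact ⟨(strandSwap m (j i) w, l), rfl⟩
  · rintro _ ⟨⟨w, l⟩, rfl⟩
    exact ⟨(strandSwap m (j i) w, l), swapPlacement_apply_strandSwap j e i w l⟩

/-- Exchanging strands moves indices only inside of their columns, and hence does not affect which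
columns are free. -/
theorem freeColumns_swapPlacement (Q : Finset (Fin n × Fin n)) (t : ℕ) (i : Fin k) :
    freeColumns Q t (swapPlacement j e) i = freeColumns Q t e i := by
  ext c
  simp only [freeColumns, Set.mem_ofPred_eq, blockSupport_swapPlacement]
  refine and_congr_right fun _ => ⟨fun h w l hw => ?_, fun h w l hw => ?_⟩
  · rw [← strandColumn_strandSwap m (j i) w]
    exact h _ l (by rwa [swapPlacement_apply_strandSwap])
  · rw [← strandColumn_strandSwap m (j i) w]
    exact h _ l hw

end Swap

/-- Cut and reglue every block at its first free column (at the column `0` if there is none). The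
rule is an involution, because the choice of the column is not affected by the exchange of the
strands. -/
noncomputable def surgery {k r n m : ℕ} (Q : Finset (Fin n × Fin n)) (t : ℕ) :
    Equiv.Perm (Placement k r n (Fin m ⊕ Fin (m + 1))) :=
  Function.Involutive.toPerm (fun e => swapPlacement (fun i => sInf (freeColumns Q t e i)) e)
    fun e => by
      simp only [freeColumns_swapPlacement]
      exact swapPlacement_swapPlacement _ e

/-- The relabelling of the placements along `strandEquiv`. -/
def strandPlacement (k r n m : ℕ) :
    Placement k r n (Fin (2 * m + 1)) ≃ Placement k r n (Fin m ⊕ Fin (m + 1)) :=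
  Equiv.embeddingCongr (Equiv.prodCongr (Equiv.refl _)
    (Equiv.prodCongr (strandEquiv m).symm (Equiv.refl _))) (Equiv.refl _)

theorem strandPlacement_apply {k r n m : ℕ} (e : Placement k r n (Fin (2 * m + 1))) (i : Fin k)
    (w : Fin m ⊕ Fin (m + 1)) (l : Fin r) :
    strandPlacement k r n m e (i, (w, l)) = e (i, (strandEquiv m w, l)) := by
  simp [strandPlacement, Equiv.embeddingCongr]

/-- By the pigeonhole principle a few indices leave two consecutive columns free. -/
theorem freeColumns_nonempty {k r n m : ℕ} (Q : Finset (Fin n × Fin n)) {t : ℕ}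
    (e : Placement k r n (Fin m ⊕ Fin (m + 1))) (i : Fin k) (ht : 2 * t + 2 ≤ m)
    (hS : (smallCover Q t (blockSupport e i)).card ≤ t) : (freeColumns Q t e i).Nonempty := by
  classical
  set S := smallCover Q t (blockSupport e i) with hSdef
  -- the columns are grouped into the pairs `2 a, 2 a + 1` for `a ≤ t`; `occ` are the occupied pairs
  set occ : Finset (Fin (t + 1)) := Finset.univ.filter fun a =>
    ∃ w l, e (i, (w, l)) ∈ S ∧ strandColumn w / 2 = a.val with hocc
  have hcard : occ.card ≤ S.card := by
    have hex : ∀ a ∈ occ, ∃ p ∈ S, ∃ w l, e (i, (w, l)) = p ∧ strandColumn w / 2 = a.val := by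
      intro a ha
      simp only [hocc, Finset.mem_filter, Finset.mem_univ, true_and] at ha
      obtain ⟨w, l, hw, ha⟩ := ha
      exact ⟨_, hw, w, l, rfl, ha⟩
    rcases occ.eq_empty_or_nonempty with h0 | ⟨a₀, ha₀⟩
    · simp [h0]
    have : Nonempty (Fin n) := ⟨(hex a₀ ha₀).choose⟩
    choose! p hp hpw using hex
    refine Finset.card_le_card_of_injOn p hp ?_
    intro a ha b hb hab
    obtain ⟨w, l, h1, h2⟩ := hpw a ha
    obtain ⟨w', l', h1', h2'⟩ := hpw b hb
    have := e.injective ((h1.trans hab).trans h1'.symm)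
    simp only [Prod.mk.injEq, true_and] at this
    rw [this.1] at h2
    exact Fin.ext (h2.symm.trans h2')
  obtain ⟨a, ha⟩ : ∃ a, a ∉ occ := by
    by_contra! hall
    have : occ = Finset.univ := Finset.eq_univ_iff_forall.2 hall
    rw [this, Finset.card_univ, Fintype.card_fin] at hcard
    omega
  refine ⟨2 * a.val, by have := a.isLt; omega, fun w l hw => ?_⟩
  have hne : strandColumn w / 2 ≠ a.val := fun h =>
    ha (by simp only [hocc, Finset.mem_filter, Finset.mem_univ, true_and]; exact ⟨w, l, hw, h⟩)
  omega

/-- If in every block the queried positions have a small cover, the surgery turns the block instance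
of the long cycle into a block instance of the two cycles with the same entries at all queried
positions. -/
theorem blockInstance_surgery {k r n m t : ℕ} (hm : 3 ≤ m) (ht : 2 * t + 2 ≤ m)
    (Q : Finset (Fin n × Fin n)) (e : Placement k r n (Fin (2 * m + 1)))
    (hgood : ∀ i, ∃ S : Finset (Fin n), S.card ≤ t ∧ CoversWithin Q (blockSupport e i) S)
    {q : Fin n × Fin n} (hq : q ∈ Q) :
    blockInstance (longCycleMatrix m) e q.1 q.2 =
      blockInstance (twoCyclesMatrix m) (surgery Q t (strandPlacement k r n m e)) q.1 q.2 := by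
  obtain ⟨p, q⟩ := q
  set e' := strandPlacement k r n m e with he'
  set j : Fin k → ℕ := fun i => sInf (freeColumns Q t e' i) with hj
  have hsurg : surgery Q t e' = swapPlacement j e' := rfl
  have hsupp : ∀ i, blockSupport e' i = blockSupport e i := by
    intro i
    apply Set.Subset.antisymm
    · rintro _ ⟨⟨w, l⟩, rfl⟩
      exact ⟨(strandEquiv m w, l), (strandPlacement_apply e i w l).symm⟩
    · rintro _ ⟨⟨v, l⟩, rfl⟩
      refine ⟨((strandEquiv m).symm v, l), ?_⟩
      simp [he', strandPlacement_apply]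
  -- the position of an index before and after the surgery
  have hpos : ∀ i w l, swapPlacement j e' (i, (strandSwap m (j i) w, l))
      = e (i, (strandEquiv m w, l)) := by
    intro i w l
    rw [swapPlacement_apply_strandSwap, he', strandPlacement_apply]
  have hrange : ∀ p, (∃ x, e x = p) ↔ ∃ i w l, e (i, (strandEquiv m w, l)) = p := by
    intro p
    constructor
    · rintro ⟨⟨i, v, l⟩, rfl⟩
      exact ⟨i, (strandEquiv m).symm v, l, by simp⟩
    · rintro ⟨i, w, l, h⟩
      exact ⟨_, h⟩
  have hrange' : ∀ p, (∃ x, swapPlacement j e' x = p) ↔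
      ∃ i w l, e (i, (strandEquiv m w, l)) = p := by
    intro p
    constructor
    · rintro ⟨⟨i, w, l⟩, rfl⟩
      exact ⟨i, strandSwap m (j i) w, l, by rw [← hpos, strandSwap_strandSwap]⟩
    · rintro ⟨i, w, l, h⟩
      exact ⟨_, (hpos i w l).trans h⟩
  rw [hsurg]
  by_cases hin : (∃ x, e x = p) ∧ ∃ y, e y = q
  swap
  · rw [blockInstance_eq_zero _ _ hin, blockInstance_eq_zero]
    rwa [hrange', hrange', ← hrange, ← hrange]
  rw [hrange, hrange] at hin
  obtain ⟨⟨i, w, l, rfl⟩, ⟨i', w', l', rfl⟩⟩ := hin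
  rw [blockInstance_apply_apply, ← hpos, ← hpos, blockInstance_apply_apply]
  by_cases hii : i = i'
  swap
  · rw [if_neg hii, if_neg hii]
  subst hii
  rw [if_pos rfl, if_pos rfl]
  have hS : (smallCover Q t (blockSupport e' i)).card ≤ t ∧
      CoversWithin Q (blockSupport e' i) (smallCover Q t (blockSupport e' i)) := by
    rw [hsupp]
    exact Classical.epsilon_spec (hgood i)
  have hji : j i ∈ freeColumns Q t e' i := Nat.sInf_mem (freeColumns_nonempty Q e' i ht hS.1)
  refine longCycleMatrix_strandEquiv hm hji.1 w w' ?_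
  -- equal vertices stay equal; a diagonal query therefore needs no cover
  by_cases hww : (w, l) = (w', l')
  · exact Or.inl (congrArg Prod.fst hww)
  refine Or.inr ?_
  have happ : ∀ w l, e (i, (strandEquiv m w, l)) = e' (i, (w, l)) := fun w l =>
    (strandPlacement_apply e i w l).symm
  have hcov := hS.2 _ hq (by simpa [Prod.ext_iff] using hww)
    ⟨(w, l), (happ w l).symm⟩ ⟨(w', l'), (happ w' l').symm⟩
  simp only [happ] at hcov
  exact hcov.imp (hji.2 w l) (hji.2 w' l')

/-- For a set `Q` of at most `k² / 9` positions, the two random block instances can be coupled so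
that they agree on `Q` with probability at least `5 / 6`. -/
theorem exists_coupling {k r n m s : ℕ} (hm : 3 ≤ m) (hs : 4 * s + 2 ≤ m) (hk : 0 < k)
    (hks : 6 * k ≤ 9 ^ s) (hn : 0 < n) (hfit : k * ((2 * m + 1) * r) ≤ n)
    (Q : Finset (Fin n × Fin n)) (hQ : 9 * Q.card ≤ k ^ 2) :
    ∃ Φ : Placement k r n (Fin (2 * m + 1)) ≃ Placement k r n (Fin m ⊕ Fin (m + 1)),
      ∃ B : Finset (Placement k r n (Fin (2 * m + 1))),
        6 * B.card ≤ Fintype.card (Placement k r n (Fin (2 * m + 1))) ∧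
        ∀ e ∉ B, ∀ q ∈ Q, blockInstance (longCycleMatrix m) e q.1 q.2 =
          blockInstance (twoCyclesMatrix m) (Φ e) q.1 q.2 := by
  classical
  refine ⟨(strandPlacement k r n m).trans (surgery Q (2 * s)), Finset.univ.filter fun e =>
    ¬ ∀ i, ∃ S : Finset (Fin n), S.card ≤ 2 * s ∧ CoversWithin Q (blockSupport e i) S, ?_, ?_⟩
  swap
  · intro e he q hq
    exact blockInstance_surgery hm (by omega) Q e (by simpa using he) hq
  set B : Finset (Placement k r n (Fin (2 * m + 1))) := Finset.univ.filter fun e =>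
    ¬ ∀ i, ∃ S : Finset (Fin n), S.card ≤ 2 * s ∧ CoversWithin Q (blockSupport e i) S with hB
  set N := Fintype.card (Placement k r n (Fin (2 * m + 1))) with hN
  have hC : Fintype.card (Fin (2 * m + 1) × Fin r) = (2 * m + 1) * r := by simp
  set c := (2 * m + 1) * r with hc
  have hcn : c ≤ n := (Nat.le_mul_of_pos_left c hk).trans hfit
  have hcard := card_embedding_with_matching_le (K := Fin k) (C := Fin (2 * m + 1) × Fin r)
    (β := Fin n) (by simpa [hC] using hcn) Q s B (by
      intro e he
      simp only [hB, Finset.mem_filter, Finset.mem_univ, true_and, not_forall] at he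
      obtain ⟨i, hi⟩ := he
      rcases exists_matching_or_cover
        {q | q ∈ Q ∧ q.1 ≠ q.2 ∧ q.1 ∈ blockSupport e i ∧ q.2 ∈ blockSupport e i}
        (fun q hq => hq.2.1) s with ⟨f, hf, hinj⟩ | ⟨S, hS, hcov⟩
      · refine ⟨i, f, fun a => (hf a).1, hinj, ?_⟩
        rintro ⟨a, b⟩
        cases b
        · exact (hf a).2.2.1
        · exact (hf a).2.2.2
      · exact absurd ⟨S, hS, fun q h1 h2 h3 h4 => hcov q ⟨h1, h2, h3, h4⟩⟩ hi)
  rw [hC, Fintype.card_fin, Fintype.card_fin] at hcard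
  clear_value c
  have h1 : B.card * 9 ^ s * n ^ (2 * s) ≤ k * N * n ^ (2 * s) := by
    calc B.card * 9 ^ s * n ^ (2 * s) = (B.card * n ^ (2 * s)) * 9 ^ s := by ring
      _ ≤ (k * Q.card ^ s * c ^ (2 * s) * N) * 9 ^ s := Nat.mul_le_mul_right _ hcard
      _ = (9 * Q.card) ^ s * (k * c ^ (2 * s) * N) := by rw [mul_pow]; ring
      _ ≤ (k ^ 2) ^ s * (k * c ^ (2 * s) * N) := Nat.mul_le_mul_right _ (Nat.pow_le_pow_left hQ s)
      _ = k * N * (k * c) ^ (2 * s) := by rw [mul_pow, ← pow_mul]; ring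
      _ ≤ k * N * n ^ (2 * s) := Nat.mul_le_mul_left _ (Nat.pow_le_pow_left hfit _)
  have h2 : B.card * 9 ^ s ≤ k * N := Nat.le_of_mul_le_mul_right h1 (by positivity)
  refine Nat.le_of_mul_le_mul_left ?_ hk
  calc k * (6 * B.card) = B.card * (6 * k) := by ring
    _ ≤ B.card * 9 ^ s := Nat.mul_le_mul_left _ hks
    _ ≤ k * N := h2

/-! ### Expected numbers of queries -/

namespace NonadaptiveAlgorithm

variable {n : ℕ} (T : NonadaptiveAlgorithm.{u} n)

theorem measurable_card_query : Measurable fun ω => ((T.query ω).card : ℝ) := by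
  let _ : MeasurableSpace (Finset (Fin n × Fin n)) := ⊤
  have h : Measurable T.query :=
    measurable_to_countable' fun S => T.measurable_query S
  exact (measurable_from_top (f := fun S : Finset (Fin n × Fin n) => (S.card : ℝ))).comp h

theorem integrable_card_query : Integrable (fun ω => ((T.query ω).card : ℝ)) T.μ := by
  refine Integrable.of_bound T.measurable_card_query.aestronglyMeasurable
    (Fintype.card (Fin n × Fin n) : ℝ) (Filter.Eventually.of_forall fun ω => ?_)
  simpa using Nat.cast_le (α := ℝ).2 (Finset.card_le_univ (T.query ω))

theorem measurableSet_output (A : Matrix (Fin n) (Fin n) ℝ) (b : Bool) :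
    MeasurableSet {ω | T.output ω A = b} := by
  cases b
  · convert (T.measurable_output A).compl using 1
    ext ω
    simp
  · exact T.measurable_output A

theorem integrable_output_indicator (A : Matrix (Fin n) (Fin n) ℝ) (b : Bool) :
    Integrable (fun ω => if T.output ω A = b then (1 : ℝ) else 0) T.μ := by
  have := (integrable_const (μ := T.μ) (1 : ℝ)).indicator (T.measurableSet_output A b)
  refine this.congr (Filter.Eventually.of_forall fun ω => ?_)
  simp [Set.indicator_apply]

theorem integral_output_indicator (A : Matrix (Fin n) (Fin n) ℝ) (b : Bool) :
    ∫ ω, (if T.output ω A = b then (1 : ℝ) else 0) ∂T.μ = T.answerProb A b := by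
  rw [answerProb, ← integral_indicator_one (T.measurableSet_output A b)]
  refine integral_congr_ae (Filter.Eventually.of_forall fun ω => ?_)
  simp [Set.indicator_apply]

/-- If two random matrices can be coupled so that, for each set of at most `q₀` positions, they
agree on it with probability at least `5 / 6`, then telling them apart takes at least `q₀ / 6`
queries on average. -/
theorem le_expectedQueries_of_coupling {ι κ : Type} [Fintype ι] [Fintype κ] [Nonempty ι]
    (D₁ : ι → Matrix (Fin n) (Fin n) ℝ) (D₂ : κ → Matrix (Fin n) (Fin n) ℝ) {q₀ : ℝ} (hq₀ : 0 < q₀)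
    (hΦ : ∀ Q : Finset (Fin n × Fin n), (Q.card : ℝ) ≤ q₀ →
      ∃ Φ : ι ≃ κ, ∃ B : Finset ι, 6 * B.card ≤ Fintype.card ι ∧
        ∀ x ∉ B, ∀ q ∈ Q, D₁ x q.1 q.2 = D₂ (Φ x) q.1 q.2)
    (hT : T.Distinguishes D₁ D₂) : q₀ / 6 ≤ T.expectedQueries := by
  classical
  set N : ℝ := (Fintype.card ι : ℝ) with hN
  have hNpos : 0 < N := by
    rw [hN]
    exact_mod_cast Fintype.card_pos
  have hcard : (Fintype.card κ : ℝ) = N := by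
    obtain ⟨Φ, -⟩ := hΦ ∅ (by simpa using hq₀.le)
    rw [hN, Fintype.card_congr Φ]
  -- for a fixed seed, only the exceptional set of the coupling lets the algorithm succeed with
  -- probability more than `1 / 2`
  -- (trivially true beyond `q₀` queries)
  have hpoint : ∀ ω, (∑ x, if T.output ω (D₁ x) = true then (1 : ℝ) else 0)
      + (∑ y, if T.output ω (D₂ y) = false then (1 : ℝ) else 0)
      ≤ N * (7 / 6) + N / q₀ * (T.query ω).card := by
    intro ω
    rcases le_or_gt ((T.query ω).card : ℝ) q₀ with h | h
    · obtain ⟨Φ, B, hB, hagree⟩ := hΦ _ h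
      rw [← Φ.sum_comp, ← Finset.sum_add_distrib]
      have hle : ∀ x, ((if T.output ω (D₁ x) = true then (1 : ℝ) else 0)
          + if T.output ω (D₂ (Φ x)) = false then (1 : ℝ) else 0)
          ≤ 1 + if x ∈ B then 1 else 0 := by
        intro x
        by_cases hx : x ∈ B
        · rw [if_pos hx]
          split_ifs <;> norm_num
        · rw [T.output_congr ω _ _ (hagree x hx)]
          cases T.output ω (D₂ (Φ x)) <;> simp [hx]
      refine (Finset.sum_le_sum fun x _ => hle x).trans ?_
      have hB' : (6 : ℝ) * B.card ≤ N := by rw [hN]; exact_mod_cast hB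
      have h0 : 0 ≤ N / q₀ * ((T.query ω).card : ℝ) := by positivity
      rw [Finset.sum_add_distrib]
      simp only [Finset.sum_const, Finset.card_univ, nsmul_eq_mul, mul_one, Finset.sum_ite_mem,
        Finset.univ_inter]
      linarith
    · have h1 : (∑ x, if T.output ω (D₁ x) = true then (1 : ℝ) else 0) ≤ N := by
        refine (Finset.sum_le_card_nsmul _ _ 1 fun x _ => ?_).trans_eq (by simp [hN])
        split_ifs <;> norm_num
      have h2 : (∑ y, if T.output ω (D₂ y) = false then (1 : ℝ) else 0) ≤ N := by
        refine (Finset.sum_le_card_nsmul _ _ 1 fun x _ => ?_).trans_eq (by simp [hcard])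
        split_ifs <;> norm_num
      have h3 : N ≤ N / q₀ * ((T.query ω).card : ℝ) := by
        rw [div_mul_eq_mul_div, le_div_iff₀ hq₀]
        exact mul_le_mul_of_nonneg_left h.le hNpos.le
      linarith
  have hint := integral_mono
    ((integrable_finsetSum Finset.univ fun x _ => T.integrable_output_indicator (D₁ x) true).add
      (integrable_finsetSum Finset.univ fun y _ => T.integrable_output_indicator (D₂ y) false))
    ((integrable_const (N * (7 / 6))).add (T.integrable_card_query.const_mul (N / q₀)))
    (fun ω => by simpa using hpoint ω)
  simp only [Pi.add_apply] at hint
  rw [integral_add (integrable_finsetSum _ fun x _ => T.integrable_output_indicator (D₁ x) true)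
      (integrable_finsetSum _ fun y _ => T.integrable_output_indicator (D₂ y) false),
    integral_finsetSum _ (fun x _ => T.integrable_output_indicator (D₁ x) true),
    integral_finsetSum _ (fun y _ => T.integrable_output_indicator (D₂ y) false),
    integral_add (integrable_const _) (T.integrable_card_query.const_mul _),
    integral_const, integral_const_mul] at hint
  simp only [integral_output_indicator, probReal_univ, one_smul] at hint
  change _ ≤ N * (7 / 6) + N / q₀ * T.expectedQueries at hint
  unfold Distinguishes at hT
  rw [hcard, ← hN, ← mul_add, ← add_div] at hT
  have hT' : 4 / 3 * N ≤ (∑ x, T.answerProb (D₁ x) true) + ∑ y, T.answerProb (D₂ y) false := by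
    rw [← le_div_iff₀ hNpos]
    linarith
  have h4 : N * (1 / 6) ≤ N * (T.expectedQueries / q₀) := by
    have h : N / q₀ * T.expectedQueries = N * (T.expectedQueries / q₀) := by ring
    linarith
  have h5 := le_of_mul_le_mul_left h4 hNpos
  rw [le_div_iff₀ hq₀] at h5
  linarith

/-- An algorithm which tells two matrices apart has to query something. -/
theorem one_third_le_expectedQueries {A B : Matrix (Fin n) (Fin n) ℝ}
    (hA : 2 / 3 ≤ T.answerProb A true) (hB : 2 / 3 ≤ T.answerProb B false) :
    1 / 3 ≤ T.expectedQueries := by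
  have hpoint : ∀ ω, (if T.output ω A = true then (1 : ℝ) else 0)
      + (if T.output ω B = false then (1 : ℝ) else 0) ≤ 1 + (T.query ω).card := by
    intro ω
    rcases (T.query ω).eq_empty_or_nonempty with h | h
    · rw [T.output_congr ω A B (by simp [h])]
      cases T.output ω B <;> simp
    · have : (1 : ℝ) ≤ (T.query ω).card := by exact_mod_cast h.card_pos
      split_ifs <;> linarith
  have hint := integral_mono
    ((T.integrable_output_indicator A true).add (T.integrable_output_indicator B false))
    ((integrable_const (1 : ℝ)).add T.integrable_card_query) hpoint
  simp only [Pi.add_apply] at hint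
  rw [integral_add (T.integrable_output_indicator A true) (T.integrable_output_indicator B false),
    integral_add (integrable_const _) T.integrable_card_query, integral_const] at hint
  simp only [integral_output_indicator, probReal_univ, one_smul] at hint
  change _ ≤ 1 + T.expectedQueries at hint
  linarith

end NonadaptiveAlgorithm

/-! ### The long cycle is positive semi-definite -/

theorem sum_cos_two_pi_mul_div {N : ℕ} (hN : 0 < N) (d : ℤ) :
    ∑ t : Fin N, Real.cos (2 * Real.pi * t * d / N) = if (N : ℤ) ∣ d then (N : ℝ) else 0 := by
  have hN0 : (N : ℂ) ≠ 0 := by exact_mod_cast hN.ne'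
  set ζ : ℂ := Complex.exp (2 * Real.pi * Complex.I * d / N) with hζ
  have hterm : ∀ t : ℕ, Real.cos (2 * Real.pi * t * d / N) = (ζ ^ t).re := by
    intro t
    rw [hζ, ← Complex.exp_nat_mul, ← Complex.exp_ofReal_mul_I_re]
    congr 2
    push_cast
    ring
  have hone : ζ = 1 ↔ (N : ℤ) ∣ d := by
    rw [hζ, Complex.exp_eq_one_iff]
    have hpi := Complex.two_pi_I_ne_zero
    constructor
    · rintro ⟨a, ha⟩
      refine ⟨a, ?_⟩
      rw [div_eq_iff hN0] at ha
      have h2 : (2 * Real.pi * Complex.I) * (d : ℂ) = (2 * Real.pi * Complex.I) * (N * a) := by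
        rw [ha]; ring
      exact_mod_cast mul_left_cancel₀ hpi h2
    · rintro ⟨a, rfl⟩
      refine ⟨a, ?_⟩
      push_cast
      field_simp
  have hpow : ζ ^ N = 1 := by
    rw [hζ, ← Complex.exp_nat_mul, Complex.exp_eq_one_iff]
    exact ⟨d, by field_simp⟩
  simp only [hterm]
  rw [Fin.sum_univ_eq_sum_range (fun t => (ζ ^ t).re), ← Complex.re_sum]
  split_ifs with h
  · simp [hone.2 h]
  · have h1 : ζ - 1 ≠ 0 := sub_ne_zero.2 fun h' => h (hone.1 h')
    have h2 := geom_sum_mul ζ N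
    rw [hpow, sub_self] at h2
    rw [(mul_eq_zero.1 h2).resolve_right h1, Complex.zero_re]

/-- `-λ` is the least eigenvalue of the cycle of length `2 m + 1`. -/
theorem neg_cycleShift_le_two_mul_cos (m : ℕ) (t : Fin (2 * m + 1)) :
    -cycleShift m ≤ 2 * Real.cos (2 * Real.pi * t / (2 * m + 1)) := by
  have hpos : (0 : ℝ) < 2 * m + 1 := by positivity
  have hpi := Real.pi_pos
  have key : ∀ a : ℕ, a ≤ m →
      Real.cos (2 * Real.pi * m / (2 * m + 1)) ≤ Real.cos (2 * Real.pi * a / (2 * m + 1)) := by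
    intro a ha
    have ha' : (a : ℝ) ≤ m := by exact_mod_cast ha
    refine Real.cos_le_cos_of_nonneg_of_le_pi (by positivity) ?_ (by gcongr)
    rw [div_le_iff₀ hpos]
    nlinarith
  have h : Real.cos (2 * Real.pi * m / (2 * m + 1)) ≤
      Real.cos (2 * Real.pi * t / (2 * m + 1)) := by
    rcases le_or_gt t.val m with h | h
    · exact key _ h
    · have ht := t.isLt
      have h1 := key (2 * m + 1 - t.val) (by omega)
      rw [Nat.cast_sub ht.le] at h1
      push_cast at h1
      have h2 : 2 * Real.pi * ((2 * m + 1) - (t.val : ℝ)) / (2 * m + 1)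
          = 2 * Real.pi - 2 * Real.pi * t / (2 * m + 1) := by
        field_simp
      rwa [h2, Real.cos_two_pi_sub] at h1
  rw [cycleShift]
  linarith

theorem cycleGraph_adj_iff_dvd {N : ℕ} (hN : 3 ≤ N) (a b : Fin N) :
    (SimpleGraph.cycleGraph N).Adj a b ↔
      ((N : ℤ) ∣ (a.val - b.val : ℤ) + 1 ∨ (N : ℤ) ∣ (a.val - b.val : ℤ) - 1) := by
  rw [cycleGraph_adj_iff_val hN]
  have ha := a.isLt
  have hb := b.isLt
  constructor
  · rintro (h | h | h | h)
    · exact Or.inl ⟨0, by omega⟩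
    · exact Or.inr ⟨0, by omega⟩
    · exact Or.inr ⟨-1, by omega⟩
    · exact Or.inl ⟨1, by omega⟩
  · rintro (⟨c, hc⟩ | ⟨c, hc⟩)
    · have h1 : c < 2 := by by_contra!; nlinarith
      have h2 : -1 < c := by by_contra!; nlinarith
      interval_cases c <;> omega
    · have h1 : c < 1 := by by_contra!; nlinarith
      have h2 : -2 < c := by by_contra!; nlinarith
      interval_cases c <;> omega

/-- A shifted cycle is diagonalized by the discrete Fourier transform, written here with sines and
cosines; it is positive semi-definite if the shift makes all the eigenvalues nonnegative. -/
theorem half_adj_add_shift_posSemidef {N : ℕ} (hN : 3 ≤ N) {l : ℝ}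
    (hl : ∀ t : Fin N, -l ≤ 2 * Real.cos (2 * Real.pi * t / N)) :
    (Matrix.of fun i j : Fin N => (1 / 2 : ℝ) *
      ((if (SimpleGraph.cycleGraph N).Adj i j then 1 else 0)
        + l * if i = j then 1 else 0)).PosSemidef := by
  have hNpos : (0 : ℝ) < N := by positivity
  set c : Fin N → ℝ := fun t => (2 * Real.cos (2 * Real.pi * t / N) + l) / (2 * N) with hc
  set u : Fin N → Fin N → ℝ := fun t i => Real.cos (2 * Real.pi * t * i / N) with hu
  set v : Fin N → Fin N → ℝ := fun t i => Real.sin (2 * Real.pi * t * i / N) with hv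
  have hc0 : ∀ t, 0 ≤ c t := fun t => div_nonneg (by linarith [hl t]) (by positivity)
  have hsum : (Matrix.of fun i j : Fin N => (1 / 2 : ℝ) *
      ((if (SimpleGraph.cycleGraph N).Adj i j then 1 else 0) + l * if i = j then 1 else 0)) =
      ∑ t, c t • (vecMulVec (u t) (star (u t)) + vecMulVec (v t) (star (v t))) := by
    ext i j
    rw [of_apply, Matrix.sum_apply]
    set d : ℤ := (i.val : ℤ) - j.val with hd
    have hterm : ∀ t : Fin N,
        (c t • (vecMulVec (u t) (star (u t)) + vecMulVec (v t) (star (v t)))) i j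
        = (1 / (2 * N)) * (Real.cos (2 * Real.pi * t * (d + 1 : ℤ) / N)
          + Real.cos (2 * Real.pi * t * (d - 1 : ℤ) / N)
          + l * Real.cos (2 * Real.pi * t * d / N)) := by
      intro t
      simp only [Matrix.smul_apply, Matrix.add_apply, vecMulVec_apply, star_trivial, smul_eq_mul,
        hu, hv, hc]
      rw [← Real.cos_sub]
      have e1 : 2 * Real.pi * t * i / N - 2 * Real.pi * t * j / N = 2 * Real.pi * t * d / N := by
        rw [hd]; push_cast; ring
      have e2 : 2 * Real.pi * t * (d + 1 : ℤ) / N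
          = 2 * Real.pi * t * d / N + 2 * Real.pi * t / N := by
        push_cast; ring
      have e3 : 2 * Real.pi * t * (d - 1 : ℤ) / N
          = 2 * Real.pi * t * d / N - 2 * Real.pi * t / N := by
        push_cast; ring
      rw [e1, e2, e3, Real.cos_add, Real.cos_sub]
      field_simp
      ring
    simp only [hterm]
    rw [← Finset.mul_sum, Finset.sum_add_distrib, Finset.sum_add_distrib, ← Finset.mul_sum,
      sum_cos_two_pi_mul_div (by omega), sum_cos_two_pi_mul_div (by omega),
      sum_cos_two_pi_mul_div (by omega)]
    have hadj := cycleGraph_adj_iff_dvd hN i j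
    rw [← hd] at hadj
    have hex : ¬ ((N : ℤ) ∣ d + 1 ∧ (N : ℤ) ∣ d - 1) := by
      rintro ⟨h1, h2⟩
      have h3 := dvd_sub h1 h2
      rw [show d + 1 - (d - 1) = 2 by ring] at h3
      have := Int.le_of_dvd (by norm_num) h3
      omega
    have heq : i = j ↔ (N : ℤ) ∣ d := by
      constructor
      · rintro rfl
        simp [hd]
      · intro h
        have hi := i.isLt
        have hj := j.isLt
        have := Int.eq_zero_of_abs_lt_dvd h (by rw [abs_lt]; constructor <;> omega)
        exact Fin.ext (by omega)
    have h1 : (if (SimpleGraph.cycleGraph N).Adj i j then (1 : ℝ) else 0) =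
        (1 / N) * ((if (N : ℤ) ∣ d + 1 then (N : ℝ) else 0)
          + if (N : ℤ) ∣ d - 1 then (N : ℝ) else 0) := by
      simp only [hadj]
      by_cases h1 : (N : ℤ) ∣ d + 1
      · have h2 : ¬ (N : ℤ) ∣ d - 1 := fun h2 => hex ⟨h1, h2⟩
        simp [h1, h2, hNpos.ne']
      · by_cases h2 : (N : ℤ) ∣ d - 1 <;> simp [h1, h2, hNpos.ne']
    have h2 : (if i = j then (1 : ℝ) else 0) = (1 / N) * if (N : ℤ) ∣ d then (N : ℝ) else 0 := by
      simp only [heq]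
      split_ifs <;> simp [hNpos.ne']
    rw [h1, h2]
    ring
  rw [hsum]
  refine posSemidef_sum _ fun t _ => ?_
  exact ((posSemidef_vecMulVec_self_star (u t)).add (posSemidef_vecMulVec_self_star (v t))).smul
    (hc0 t)

theorem longCycleMatrix_posSemidef {m : ℕ} (hm : 3 ≤ m) : (longCycleMatrix m).PosSemidef := by
  have h := half_adj_add_shift_posSemidef (N := 2 * m + 1) (by omega) (l := cycleShift m) (by
    intro t
    have := neg_cycleShift_le_two_mul_cos m t
    push_cast
    exact this)
  refine (congrArg PosSemidef ?_).mpr h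
  ext i j
  rw [longCycleMatrix_apply, of_apply]

/-! ### Symmetry and size of the entries -/

theorem abs_cycleShift_le (m : ℕ) : |cycleShift m| ≤ 2 := by
  rw [cycleShift, abs_le]
  have h1 := Real.cos_le_one (2 * Real.pi * m / (2 * m + 1))
  have h2 := Real.neg_one_le_cos (2 * Real.pi * m / (2 * m + 1))
  constructor <;> linarith

theorem abs_half_adj_add_shift_le {V : Type*} [DecidableEq V] (G : SimpleGraph V)
    [DecidableRel G.Adj] (m : ℕ) (v w : V) :
    |(1 / 2) * ((if G.Adj v w then 1 else 0) + cycleShift m * if v = w then 1 else 0)| ≤ 1 := by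
  have h := abs_cycleShift_le m
  rw [abs_le] at h ⊢
  by_cases hvw : v = w
  · subst hvw
    simp only [G.irrefl, if_false, if_true]
    constructor <;> linarith
  · rw [if_neg hvw]
    split_ifs <;> norm_num

theorem abs_longCycleMatrix_le (m : ℕ) (v w : Fin (2 * m + 1)) : |longCycleMatrix m v w| ≤ 1 := by
  rw [longCycleMatrix_apply]
  exact abs_half_adj_add_shift_le _ m v w

theorem abs_twoCyclesMatrix_le (m : ℕ) (v w : Fin m ⊕ Fin (m + 1)) :
    |twoCyclesMatrix m v w| ≤ 1 := by
  rcases v with v | v <;> rcases w with w | w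
  · rw [twoCyclesMatrix_inl_inl]
    exact abs_half_adj_add_shift_le _ m v w
  · simp [twoCyclesMatrix_inl_inr]
  · simp [twoCyclesMatrix_inr_inl]
  · rw [twoCyclesMatrix_inr_inr]
    exact abs_half_adj_add_shift_le _ m v w

theorem longCycleMatrix_isSymm (m : ℕ) : (longCycleMatrix m).IsSymm := by
  ext v w
  simp only [transpose_apply, longCycleMatrix_apply, SimpleGraph.adj_comm _ v w, eq_comm (a := v)]

theorem twoCyclesMatrix_isSymm (m : ℕ) : (twoCyclesMatrix m).IsSymm := by
  ext v w
  rw [transpose_apply]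
  rcases v with v | v <;> rcases w with w | w
  · simp only [twoCyclesMatrix_inl_inl, SimpleGraph.adj_comm _ v w, eq_comm (a := v)]
  · rw [twoCyclesMatrix_inl_inr, twoCyclesMatrix_inr_inl]
  · rw [twoCyclesMatrix_inl_inr, twoCyclesMatrix_inr_inl]
  · simp only [twoCyclesMatrix_inr_inr, SimpleGraph.adj_comm _ v w, eq_comm (a := v)]

/-! ### The two cycles are far from positive semi-definite -/

/-- The least eigenvalue `-2` of an even cycle, witnessed by the alternating vector. -/
theorem sum_alternating_cycle {N : ℕ} (hN : 3 ≤ N) (heven : Even N) (l : ℝ) :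
    ∑ i : Fin N, ∑ j : Fin N, (-1 : ℝ) ^ i.val * ((1 / 2) *
      ((if (SimpleGraph.cycleGraph N).Adj i j then 1 else 0) + l * if i = j then 1 else 0))
        * (-1) ^ j.val = -((2 - l) / 2) * N := by
  have hterm : ∀ i j : Fin N, (-1 : ℝ) ^ i.val * ((1 / 2) *
      ((if (SimpleGraph.cycleGraph N).Adj i j then 1 else 0) + l * if i = j then 1 else 0))
        * (-1) ^ j.val = (1 / 2) * (-(if (SimpleGraph.cycleGraph N).Adj i j then 1 else 0)
          + l * if i = j then 1 else 0) := by
    intro i j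
    by_cases hij : i = j
    · subst hij
      simp only [SimpleGraph.irrefl, if_false, if_true]
      have : (-1 : ℝ) ^ i.val * (-1) ^ i.val = 1 := by
        rw [← mul_pow]; simp
      linear_combination (l / 2) * this
    · rw [if_neg hij]
      by_cases hadj : (SimpleGraph.cycleGraph N).Adj i j
      · rw [if_pos hadj]
        have hodd : Odd (i.val + j.val) := by
          rw [cycleGraph_adj_iff_val hN] at hadj
          rw [Nat.odd_iff]
          rw [Nat.even_iff] at heven
          omega
        have : (-1 : ℝ) ^ i.val * (-1) ^ j.val = -1 := by
          rw [← pow_add, hodd.neg_one_pow]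
        linear_combination (1 / 2) * this
      · rw [if_neg hadj]
        ring
  simp only [hterm, ← Finset.mul_sum, Finset.sum_add_distrib, Finset.sum_neg_distrib]
  have hdeg : ∀ i : Fin N,
      (∑ j, if (SimpleGraph.cycleGraph N).Adj i j then (1 : ℝ) else 0) = 2 := by
    intro i
    obtain ⟨N, rfl⟩ := Nat.exists_eq_add_of_le' hN
    have := SimpleGraph.cycleGraph_degree_three_le (v := i)
    rw [Finset.sum_boole, ← SimpleGraph.neighborFinset_eq_filter,
      SimpleGraph.card_neighborFinset_eq_degree, this]
    norm_num
  simp only [hdeg]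
  simp
  ring

theorem exists_negative_direction_twoCyclesMatrix {m : ℕ} (hm : 3 ≤ m) :
    ∃ z : Fin m ⊕ Fin (m + 1) → ℝ, 0 < ∑ v, z v ^ 2 ∧
      ∑ v, ∑ w, z v * twoCyclesMatrix m v w * z w =
        -((2 - cycleShift m) / 2) * ∑ v, z v ^ 2 := by
  have hsq : ∀ i : ℕ, ((-1 : ℝ) ^ i) ^ 2 = 1 := fun i => by
    rw [← pow_mul, mul_comm, pow_mul]; simp
  rcases Nat.even_or_odd m with h | h
  · have hz : ∑ v : Fin m ⊕ Fin (m + 1),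
        (Sum.elim (fun i : Fin m => (-1 : ℝ) ^ i.val) 0 v) ^ 2 = m := by
      simp [hsq]
    refine ⟨Sum.elim (fun i => (-1) ^ i.val) 0, ?_, ?_⟩ <;> rw [hz]
    · exact_mod_cast (by omega : 0 < m)
    · rw [← sum_alternating_cycle hm h (cycleShift m)]
      simp [twoCyclesMatrix_inl_inl]
  · have hz : ∑ v : Fin m ⊕ Fin (m + 1),
        (Sum.elim (0 : Fin m → ℝ) (fun i : Fin (m + 1) => (-1 : ℝ) ^ i.val) v) ^ 2
          = (m + 1 : ℕ) := by
      simp [hsq]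
    refine ⟨Sum.elim 0 (fun i => (-1) ^ i.val), ?_, ?_⟩ <;> rw [hz]
    · positivity
    · rw [← sum_alternating_cycle (by omega) h.add_one (cycleShift m)]
      simp [twoCyclesMatrix_inr_inr]

/-- A negative direction `z` of `M` keeps `M ⊗ J` away from the positive semi-definite cone: pair
the difference with the rank one matrix `(z ⊗ 1) (z ⊗ 1)ᵀ`. -/
theorem sq_mul_sq_le_sum_sub_sq {V : Type*} [Fintype V] {r : ℕ} {M : Matrix V V ℝ} {z : V → ℝ}
    {μ : ℝ} (hμ : 0 ≤ μ) (hz : 0 < ∑ v, z v ^ 2)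
    (hMz : ∑ v, ∑ w, z v * M v w * z w = -μ * ∑ v, z v ^ 2)
    {B : Matrix (V × Fin r) (V × Fin r) ℝ} (hB : B.PosSemidef) :
    (r : ℝ) ^ 2 * μ ^ 2 ≤ ∑ a, ∑ b, (M a.1 b.1 - B a b) ^ 2 := by
  set Z := ∑ v, z v ^ 2 with hZ
  have hBz : 0 ≤ ∑ a : V × Fin r, ∑ b : V × Fin r, z a.1 * B a b * z b.1 := by
    have := hB.dotProduct_mulVec_nonneg fun a : V × Fin r => z a.1
    simpa [dotProduct, mulVec, Finset.mul_sum, mul_assoc] using this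
  have hM : ∑ a : V × Fin r, ∑ b : V × Fin r, z a.1 * M a.1 b.1 * z b.1 = r ^ 2 * (-μ * Z) := by
    rw [← hMz]
    simp only [Fintype.sum_prod_type, Finset.sum_const, Finset.card_univ, Fintype.card_fin,
      nsmul_eq_mul, ← Finset.mul_sum]
    ring
  have hzz : ∑ a : V × Fin r, ∑ b : V × Fin r, (z a.1 * z b.1) ^ 2 = r ^ 2 * Z ^ 2 := by
    have h : ∑ a : V × Fin r, z a.1 ^ 2 = r * Z := by
      rw [hZ]
      simp only [Fintype.sum_prod_type, Finset.sum_const, Finset.card_univ, Fintype.card_fin,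
        nsmul_eq_mul, ← Finset.mul_sum]
    simp only [mul_pow, ← Finset.mul_sum, ← Finset.sum_mul, h]
    ring
  -- the square of the difference, shifted by the multiple `μ / Z` of the rank one matrix
  have hpos : 0 ≤ ∑ a : V × Fin r, ∑ b : V × Fin r,
      ((M a.1 b.1 - B a b) + μ / Z * (z a.1 * z b.1)) ^ 2 :=
    Finset.sum_nonneg fun a _ => Finset.sum_nonneg fun b _ => sq_nonneg _
  have hexp : ∑ a : V × Fin r, ∑ b : V × Fin r,
      ((M a.1 b.1 - B a b) + μ / Z * (z a.1 * z b.1)) ^ 2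
      = (∑ a : V × Fin r, ∑ b : V × Fin r, (M a.1 b.1 - B a b) ^ 2)
        + 2 * (μ / Z) * ((∑ a : V × Fin r, ∑ b : V × Fin r, z a.1 * M a.1 b.1 * z b.1)
          - ∑ a : V × Fin r, ∑ b : V × Fin r, z a.1 * B a b * z b.1)
        + (μ / Z) ^ 2 * ∑ a : V × Fin r, ∑ b : V × Fin r, (z a.1 * z b.1) ^ 2 := by
    simp only [Finset.mul_sum, ← Finset.sum_add_distrib, ← Finset.sum_sub_distrib]
    refine Finset.sum_congr rfl fun a _ => Finset.sum_congr rfl fun b _ => ?_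
    ring
  rw [hexp, hM, hzz] at hpos
  have h1 : 2 * (μ / Z) * ((r : ℝ) ^ 2 * (-μ * Z)) = -2 * (r ^ 2 * μ ^ 2) := by
    field_simp
  have h2 : (μ / Z) ^ 2 * ((r : ℝ) ^ 2 * Z ^ 2) = r ^ 2 * μ ^ 2 := by
    field_simp
  rw [mul_sub, h1, h2] at hpos
  have h3 := mul_nonneg (by positivity : 0 ≤ 2 * (μ / Z)) hBz
  linarith

theorem farFromPSD_blockInstance {k r n : ℕ} {V : Type} [Fintype V] {M : Matrix V V ℝ} {z : V → ℝ}
    {μ ε : ℝ} (hμ : 0 ≤ μ) (hz : 0 < ∑ v, z v ^ 2)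
    (hMz : ∑ v, ∑ w, z v * M v w * z w = -μ * ∑ v, z v ^ 2)
    (hε : ε * (n : ℝ) ^ 2 ≤ k * (r ^ 2 * μ ^ 2)) (e : Placement k r n V) :
    FarFromPSD ε (blockInstance M e) := by
  intro B hB
  refine hε.trans ?_
  have hblock : ∀ i : Fin k, (r : ℝ) ^ 2 * μ ^ 2 ≤ ∑ a : V × Fin r, ∑ b : V × Fin r,
      (blockInstance M e (e (i, a)) (e (i, b)) - B (e (i, a)) (e (i, b))) ^ 2 := by
    intro i
    have := sq_mul_sq_le_sum_sub_sq hμ hz hMz (hB.submatrix fun a : V × Fin r => e (i, a))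
    simpa [blockInstance_apply_apply] using this
  have hinj : Function.Injective fun x : Fin k × ((V × Fin r) × (V × Fin r)) =>
      (e (x.1, x.2.1), e (x.1, x.2.2)) := by
    rintro ⟨i, a, b⟩ ⟨i', a', b'⟩ h
    simp only [Prod.mk.injEq, EmbeddingLike.apply_eq_iff_eq] at h ⊢
    tauto
  calc (k : ℝ) * (r ^ 2 * μ ^ 2) = ∑ i : Fin k, (r : ℝ) ^ 2 * μ ^ 2 := by simp
    _ ≤ ∑ i : Fin k, ∑ a : V × Fin r, ∑ b : V × Fin r,
      (blockInstance M e (e (i, a)) (e (i, b)) - B (e (i, a)) (e (i, b))) ^ 2 :=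
      Finset.sum_le_sum fun i _ => hblock i
    _ = ∑ x : Fin k × ((V × Fin r) × (V × Fin r)), (fun p : Fin n × Fin n =>
        (blockInstance M e p.1 p.2 - B p.1 p.2) ^ 2) (e (x.1, x.2.1), e (x.1, x.2.2)) := by
      rw [Fintype.sum_prod_type]
      refine Finset.sum_congr rfl fun i _ => ?_
      exact (Fintype.sum_prod_type fun y : (V × Fin r) × (V × Fin r) =>
        (blockInstance M e (e (i, y.1)) (e (i, y.2)) - B (e (i, y.1)) (e (i, y.2))) ^ 2).symm
    _ = ∑ p ∈ Finset.univ.map ⟨_, hinj⟩,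
        (blockInstance M e p.1 p.2 - B p.1 p.2) ^ 2 := by
      rw [Finset.sum_map]
      rfl
    _ ≤ ∑ p : Fin n × Fin n, (blockInstance M e p.1 p.2 - B p.1 p.2) ^ 2 :=
      Finset.sum_le_univ_sum_of_nonneg fun p => sq_nonneg _
    _ = _ := by rw [Fintype.sum_prod_type]

/-- The least eigenvalue of the even one of the two short cycles lies below zero by a gap of order
`m⁻²`, because `λ = 2 cos (π / (2 m + 1))`. -/
theorem two_div_sq_le_shift_gap (m : ℕ) :
    2 / (2 * m + 1 : ℝ) ^ 2 ≤ (2 - cycleShift m) / 2 := by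
  have hpos : (0 : ℝ) < 2 * m + 1 := by positivity
  have hpi := Real.pi_pos
  have h1 : cycleShift m = 2 * Real.cos (Real.pi / (2 * m + 1)) := by
    have : 2 * Real.pi * m / (2 * m + 1) = Real.pi - Real.pi / (2 * m + 1) := by
      field_simp
      ring
    rw [cycleShift, this, Real.cos_pi_sub]
    ring
  have h2 := Real.cos_le_one_sub_mul_cos_sq (x := Real.pi / (2 * m + 1)) (by
    rw [abs_of_pos (by positivity)]
    exact div_le_self hpi.le (by linarith [(Nat.cast_nonneg m : (0 : ℝ) ≤ m)]))
  have h3 : 2 / Real.pi ^ 2 * (Real.pi / (2 * m + 1)) ^ 2 = 2 / (2 * m + 1 : ℝ) ^ 2 := by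
    field_simp
  rw [h1]
  linarith

/-! ### Choice of the parameters -/

/-- With `ℓ = log (1 / ε)`, the cycles of length at most `21 ℓ` are so short that
`1 / (ε (2 m + 1)⁶)`, the intended number of blocks, is at least `1`. -/
theorem pow_six_le_exp {ℓ : ℝ} (hℓ : 5040 * 21 ^ 6 ≤ ℓ) : (21 * ℓ) ^ 6 ≤ Real.exp ℓ := by
  have h0 : 0 ≤ ℓ := le_trans (by norm_num) hℓ
  have h := Real.pow_div_factorial_le_exp ℓ h0 7
  refine le_trans ?_ h
  rw [le_div_iff₀ (by positivity), show (Nat.factorial 7 : ℝ) = 5040 by norm_num [Nat.factorial]]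
  have h6 : 0 ≤ ℓ ^ 6 := by positivity
  calc (21 * ℓ) ^ 6 * 5040 = (5040 * 21 ^ 6) * ℓ ^ 6 := by ring
    _ ≤ ℓ * ℓ ^ 6 := mul_le_mul_of_nonneg_right hℓ h6
    _ = ℓ ^ 7 := by ring

theorem nonempty_placement {k r n : ℕ} {V : Type} [Fintype V]
    (h : k * (Fintype.card V * r) ≤ n) : Nonempty (Placement k r n V) := by
  refine Function.Embedding.nonempty_of_card_le ?_
  simpa using h

/-- The number of queries needed to tell the two random block instances apart, in terms of the
number `k` of the blocks. -/
theorem sq_div_le_expectedQueries {k r n m s : ℕ} (hm : 3 ≤ m) (hs : 4 * s + 2 ≤ m) (hk : 0 < k)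
    (hks : 6 * k ≤ 9 ^ s) (hn : 0 < n) (hfit : k * ((2 * m + 1) * r) ≤ n)
    (T : NonadaptiveAlgorithm.{u} n)
    (hT : T.Distinguishes
      (fun e : Placement k r n (Fin (2 * m + 1)) => blockInstance (longCycleMatrix m) e)
      (fun e : Placement k r n (Fin m ⊕ Fin (m + 1)) => blockInstance (twoCyclesMatrix m) e)) :
    (k : ℝ) ^ 2 / 54 ≤ T.expectedQueries := by
  have : Nonempty (Placement k r n (Fin (2 * m + 1))) := nonempty_placement (by simpa using hfit)
  have h := T.le_expectedQueries_of_coupling _ _ (q₀ := (k : ℝ) ^ 2 / 9) (by positivity)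
    (fun Q hQ => exists_coupling hm hs hk hks hn hfit Q (by
      rw [le_div_iff₀ (by norm_num)] at hQ
      have : (9 : ℝ) * Q.card ≤ k ^ 2 := by linarith
      exact_mod_cast this)) hT
  linarith

/-- The hard instances. With `ℓ = log (1 / ε)`, the cycles have length of order `ℓ`, and there are
of order `1 / (ε ℓ⁶)` blocks, the largest number for which the gap of order `ℓ⁻²` in the spectrum
of a block still adds up to a squared distance of `ε n²`. -/
theorem exists_hard_block_instances {n : ℕ} {ε : ℝ} (hε : 0 < ε)
    (hℓ : 5040 * 21 ^ 6 ≤ Real.log (1 / ε)) (hn : 1 / ε ≤ (n : ℝ)) :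
    ∃ m k r : ℕ, 3 ≤ m ∧ 1 * Real.log (1 / ε) ≤ (m : ℝ) ∧ (m : ℝ) ≤ 10 * Real.log (1 / ε) ∧
      k * ((2 * m + 1) * r) ≤ n ∧
      (∀ e : Placement k r n (Fin (2 * m + 1)),
        (blockInstance (longCycleMatrix m) e).IsSymm ∧
        EntryBounded (blockInstance (longCycleMatrix m) e) ∧
        (blockInstance (longCycleMatrix m) e).PosSemidef) ∧
      (∀ e : Placement k r n (Fin m ⊕ Fin (m + 1)),
        (blockInstance (twoCyclesMatrix m) e).IsSymm ∧
        EntryBounded (blockInstance (twoCyclesMatrix m) e) ∧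
        FarFromPSD ε (blockInstance (twoCyclesMatrix m) e)) ∧
      ∀ T : NonadaptiveAlgorithm.{u} n,
        T.Distinguishes
          (fun e : Placement k r n (Fin (2 * m + 1)) => blockInstance (longCycleMatrix m) e)
          (fun e : Placement k r n (Fin m ⊕ Fin (m + 1)) => blockInstance (twoCyclesMatrix m) e) →
        1 / (216 * 21 ^ 12) * (1 / ε ^ 2) / (1 + Real.log (1 / ε)) ^ 12 ≤ T.expectedQueries := by
  set ℓ := Real.log (1 / ε) with hℓdef
  set X := 1 / ε with hX
  have hXpos : 0 < X := by positivity
  have hexp : Real.exp ℓ = X := Real.exp_log hXpos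
  have hℓ1 : 1 ≤ ℓ := le_trans (by norm_num) hℓ
  set s := ⌈ℓ⌉₊ with hs
  have hs1 : ℓ ≤ s := Nat.le_ceil ℓ
  have hs2 : (s : ℝ) < ℓ + 1 := Nat.ceil_lt_add_one (by linarith)
  set m := 4 * s + 2 with hm
  have hm3 : 3 ≤ m := by
    have : (1 : ℝ) ≤ s := hℓ1.trans hs1
    have : 1 ≤ s := by exact_mod_cast this
    omega
  have hmR : (m : ℝ) = 4 * s + 2 := by rw [hm]; push_cast; ring
  set w : ℝ := 2 * m + 1 with hw
  have hw1 : 1 ≤ w := by rw [hw, hmR]; linarith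
  have hw21 : w ≤ 21 * ℓ := by rw [hw, hmR]; linarith
  have hwX : w ^ 6 ≤ X := by
    rw [← hexp]
    exact (pow_le_pow_left₀ (by linarith) hw21 6).trans (pow_six_le_exp hℓ)
  have hw6 : 1 ≤ w ^ 6 := one_le_pow₀ hw1
  -- the number of blocks
  set k := ⌊X / w ^ 6⌋₊ with hk
  have hk1 : (k : ℝ) * w ^ 6 ≤ X := by
    rw [← le_div_iff₀ (by positivity)]
    exact Nat.floor_le (by positivity)
  have hkpos : 0 < k := by
    rw [hk, Nat.floor_pos, le_div_iff₀ (by positivity)]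
    linarith
  have hkR : (1 : ℝ) ≤ k := by exact_mod_cast hkpos
  have hk2 : X ≤ 2 * k * w ^ 6 := by
    have h := Nat.lt_floor_add_one (X / w ^ 6)
    rw [← hk, div_lt_iff₀ (by positivity)] at h
    nlinarith
  -- the multiplicity of the vertices, for which the blocks fill at least half of the indices
  set r := n / (k * (2 * m + 1)) with hr
  have hkw : (k : ℝ) * w ≤ n := by
    refine le_trans ?_ (hk1.trans hn)
    exact mul_le_mul_of_nonneg_left (le_self_pow₀ hw1 (by norm_num)) (by linarith)
  have hcast : ((k * (2 * m + 1) : ℕ) : ℝ) = k * w := by rw [hw]; push_cast; ring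
  have hkwN : k * (2 * m + 1) ≤ n := by
    have : ((k * (2 * m + 1) : ℕ) : ℝ) ≤ n := by rw [hcast]; exact hkw
    exact_mod_cast this
  have hfit : k * ((2 * m + 1) * r) ≤ n := by
    rw [← mul_assoc]
    exact Nat.mul_div_le n _
  have hnpos : 0 < n := by
    have : 0 < k * (2 * m + 1) := by positivity
    omega
  have hr2 : (n : ℝ) ≤ 2 * (k * w * r) := by
    have h1 : 1 ≤ r := (Nat.one_le_div_iff (by positivity)).2 hkwN
    have h2 : n < k * (2 * m + 1) * (r + 1) := by
      rw [mul_comm]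
      exact (Nat.lt_mul_of_div_lt (Nat.lt_succ_self _) (by positivity))
    have h3 : n ≤ 2 * (k * (2 * m + 1) * r) := by nlinarith
    rw [← hcast]
    exact_mod_cast h3
  refine ⟨m, k, r, hm3, ?_, ?_, hfit, fun e => ?_, fun e => ?_, fun T hT => ?_⟩
  · rw [hmR]; linarith
  · rw [hmR]; linarith
  · exact ⟨blockInstance_isSymm (longCycleMatrix_isSymm m) e,
      blockInstance_entryBounded (abs_longCycleMatrix_le m) e,
      blockInstance_posSemidef (longCycleMatrix_posSemidef hm3) e⟩
  · refine ⟨blockInstance_isSymm (twoCyclesMatrix_isSymm m) e,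
      blockInstance_entryBounded (abs_twoCyclesMatrix_le m) e, ?_⟩
    obtain ⟨z, hz, hMz⟩ := exists_negative_direction_twoCyclesMatrix hm3
    have hgap := two_div_sq_le_shift_gap m
    rw [← hw] at hgap
    set μ := (2 - cycleShift m) / 2 with hμ
    have hgap0 : 0 ≤ 2 / w ^ 2 := by positivity
    refine farFromPSD_blockInstance (hgap0.trans hgap) hz hMz ?_ e
    have hεX : ε * X = 1 := by rw [hX]; field_simp
    have h1 : (2 / w ^ 2) ^ 2 ≤ μ ^ 2 := pow_le_pow_left₀ hgap0 hgap 2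
    have h2 : (n : ℝ) ^ 2 ≤ (2 * (k * w * r)) ^ 2 := pow_le_pow_left₀ (by positivity) hr2 2
    have h3 : ε * (k * w ^ 6) ≤ 1 := by
      rw [← hεX]
      exact mul_le_mul_of_nonneg_left hk1 hε.le
    calc ε * (n : ℝ) ^ 2 ≤ ε * (2 * (k * w * r)) ^ 2 := mul_le_mul_of_nonneg_left h2 hε.le
      _ = (ε * (k * w ^ 6)) * (k * (r ^ 2 * (2 / w ^ 2) ^ 2)) := by field_simp
      _ ≤ 1 * (k * (r ^ 2 * (2 / w ^ 2) ^ 2)) := mul_le_mul_of_nonneg_right h3 (by positivity)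
      _ ≤ k * (r ^ 2 * μ ^ 2) := by rw [one_mul]; gcongr
  · -- `s ≥ log (1 / ε)` makes the union bound over the blocks effective
    have hks : 6 * k ≤ 9 ^ s := by
      have h1 : (6 * k : ℝ) ≤ X := by
        have hw6' : (6 : ℝ) ≤ w ^ 6 := by
          have h2 : (2 : ℝ) ≤ w := by rw [hw, hmR]; linarith
          calc (6 : ℝ) ≤ 2 ^ 6 := by norm_num
            _ ≤ w ^ 6 := pow_le_pow_left₀ (by norm_num) h2 6
        nlinarith
      have h2 : X ≤ (9 : ℝ) ^ s := by
        rw [← hexp]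
        calc Real.exp ℓ ≤ Real.exp s := Real.exp_le_exp.2 hs1
          _ = Real.exp 1 ^ s := by rw [← Real.exp_nat_mul, mul_one]
          _ ≤ 9 ^ s := pow_le_pow_left₀ (Real.exp_pos 1).le
            (by linarith [Real.exp_one_lt_d9]) s
      exact_mod_cast h1.trans h2
    refine le_trans ?_ (sq_div_le_expectedQueries hm3 le_rfl hkpos hks hnpos hfit T hT)
    have hX2 : 1 / ε ^ 2 = X ^ 2 := by rw [hX]; ring
    have h1 : X ^ 2 ≤ (2 * k * w ^ 6) ^ 2 := pow_le_pow_left₀ hXpos.le hk2 2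
    have h2 : w ^ 12 ≤ (21 * (1 + ℓ)) ^ 12 := pow_le_pow_left₀ (by linarith) (by linarith) 12
    rw [hX2, div_le_iff₀ (by positivity)]
    calc 1 / (216 * 21 ^ 12) * X ^ 2 ≤ 1 / (216 * 21 ^ 12) * (2 * k * w ^ 6) ^ 2 := by gcongr
      _ = (4 * k ^ 2 / (216 * 21 ^ 12)) * w ^ 12 := by ring
      _ ≤ (4 * k ^ 2 / (216 * 21 ^ 12)) * (21 * (1 + ℓ)) ^ 12 := by gcongr
      _ = (k : ℝ) ^ 2 / 54 * (1 + ℓ) ^ 12 := by rw [mul_pow]; ring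

/-! ### The lower bound for testing -/

theorem FarFromPSD.mono {n : ℕ} {ε ε' : ℝ} {A : Matrix (Fin n) (Fin n) ℝ} (h : FarFromPSD ε' A)
    (hε : ε ≤ ε') : FarFromPSD ε A := fun B hB =>
  (mul_le_mul_of_nonneg_right hε (sq_nonneg _)).trans (h B hB)

/-- The negative of the all-ones matrix is as far from the positive semi-definite matrices as any
matrix with bounded entries can be. -/
theorem farFromPSD_neg_one {n : ℕ} {ε : ℝ} (hε : ε ≤ 1) :
    FarFromPSD ε (Matrix.of fun _ _ => -1 : Matrix (Fin n) (Fin n) ℝ) := by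
  intro B hB
  have h := hB.dotProduct_mulVec_nonneg fun _ => 1
  have h' : 0 ≤ ∑ i, ∑ j, B i j := by simpa [dotProduct, mulVec] using h
  calc ε * (n : ℝ) ^ 2 ≤ 1 * (n : ℝ) ^ 2 := mul_le_mul_of_nonneg_right hε (sq_nonneg _)
    _ ≤ ∑ i : Fin n, ∑ j : Fin n, (1 + 2 * B i j) := by
      simp only [Finset.sum_add_distrib, ← Finset.mul_sum, Finset.sum_const, Finset.card_univ,
        Fintype.card_fin, nsmul_eq_mul, mul_one]
      nlinarith
    _ ≤ _ := by
      refine Finset.sum_le_sum fun i _ => Finset.sum_le_sum fun j _ => ?_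
      rw [of_apply]
      nlinarith [sq_nonneg (B i j)]

theorem NonadaptiveAlgorithm.SolvesPSDTesting.one_third_le {n : ℕ} {ε : ℝ}
    {T : NonadaptiveAlgorithm.{u} n} (hT : T.SolvesPSDTesting ε) (hε : ε ≤ 1) :
    1 / 3 ≤ T.expectedQueries := by
  refine T.one_third_le_expectedQueries
    ((hT 0 isSymm_zero fun i j => by simp).1 PosSemidef.zero)
    ((hT (Matrix.of fun _ _ => -1) ?_ ?_).2 (farFromPSD_neg_one hε))
  · ext i j
    simp
  · intro i j
    simp

theorem NonadaptiveAlgorithm.SolvesPSDTesting.distinguishes {n : ℕ} {ε : ℝ}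
    {T : NonadaptiveAlgorithm.{u} n} (hT : T.SolvesPSDTesting ε) {ι κ : Type} [Fintype ι]
    [Fintype κ] [Nonempty ι] [Nonempty κ] {D₁ : ι → Matrix (Fin n) (Fin n) ℝ}
    {D₂ : κ → Matrix (Fin n) (Fin n) ℝ}
    (h₁ : ∀ x, (D₁ x).IsSymm ∧ EntryBounded (D₁ x) ∧ (D₁ x).PosSemidef)
    (h₂ : ∀ y, (D₂ y).IsSymm ∧ EntryBounded (D₂ y) ∧ FarFromPSD ε (D₂ y)) :
    T.Distinguishes D₁ D₂ := by
  have e₁ : 2 / 3 ≤ (∑ x, T.answerProb (D₁ x) true) / Fintype.card ι := by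
    rw [le_div_iff₀ (by exact_mod_cast Fintype.card_pos), mul_comm, ← nsmul_eq_mul,
      ← Finset.card_univ]
    exact Finset.card_nsmul_le_sum _ _ _ fun x _ => (hT _ (h₁ x).1 (h₁ x).2.1).1 (h₁ x).2.2
  have e₂ : 2 / 3 ≤ (∑ y, T.answerProb (D₂ y) false) / Fintype.card κ := by
    rw [le_div_iff₀ (by exact_mod_cast Fintype.card_pos), mul_comm, ← nsmul_eq_mul,
      ← Finset.card_univ]
    exact Finset.card_nsmul_le_sum _ _ _ fun y _ => (hT _ (h₂ y).1 (h₂ y).2.1).2 (h₂ y).2.2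
  unfold Distinguishes
  linarith

theorem mainTheorem3 :
    ∃ (c : ℝ) (p : ℕ), 0 < c ∧
      -- the lower bound, for all dimensions and all gaps
      (∀ (n : ℕ) (ε : ℝ), 1 ≤ n → 0 < ε → ε ≤ 1 →
        ∀ T : NonadaptiveAlgorithm.{u} n, T.SolvesPSDTesting ε →
          c * min ((n : ℝ) ^ 2) (1 / ε ^ 2) / (1 + Real.log (1 / ε)) ^ p ≤ T.expectedQueries) ∧
      -- the hard instances that witness it
      (∃ a b ε₀ : ℝ, 0 < a ∧ 0 < b ∧ 0 < ε₀ ∧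
        ∀ (n : ℕ) (ε : ℝ), 0 < ε → ε < ε₀ → 1 / ε ≤ (n : ℝ) →
          ∃ m k r : ℕ, 3 ≤ m ∧
            a * Real.log (1 / ε) ≤ (m : ℝ) ∧ (m : ℝ) ≤ b * Real.log (1 / ε) ∧
            k * ((2 * m + 1) * r) ≤ n ∧
            (∀ e : Placement k r n (Fin (2 * m + 1)),
              (blockInstance (longCycleMatrix m) e).IsSymm ∧
              EntryBounded (blockInstance (longCycleMatrix m) e) ∧
              (blockInstance (longCycleMatrix m) e).PosSemidef) ∧
            (∀ e : Placement k r n (Fin m ⊕ Fin (m + 1)),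
              (blockInstance (twoCyclesMatrix m) e).IsSymm ∧
              EntryBounded (blockInstance (twoCyclesMatrix m) e) ∧
              FarFromPSD ε (blockInstance (twoCyclesMatrix m) e)) ∧
            ∀ T : NonadaptiveAlgorithm.{u} n,
              T.Distinguishes
                (fun e : Placement k r n (Fin (2 * m + 1)) =>
                  blockInstance (longCycleMatrix m) e)
                (fun e : Placement k r n (Fin m ⊕ Fin (m + 1)) =>
                  blockInstance (twoCyclesMatrix m) e) →
              c * (1 / ε ^ 2) / (1 + Real.log (1 / ε)) ^ p ≤ T.expectedQueries) := by
  set c₁ : ℝ := 1 / (216 * 21 ^ 12) with hc₁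
  have hc₁pos : 0 < c₁ := by positivity
  set ε₀ : ℝ := Real.exp (-(5040 * 21 ^ 6)) with hε₀
  have hε₀pos : 0 < ε₀ := Real.exp_pos _
  have hlog : ∀ ε : ℝ, 0 < ε → ε < ε₀ → 5040 * 21 ^ 6 ≤ Real.log (1 / ε) := by
    intro ε hε h
    have h' := Real.log_lt_log hε h
    rw [hε₀, Real.log_exp] at h'
    rw [one_div, Real.log_inv]
    linarith
  set c : ℝ := min c₁ (ε₀ ^ 2 / 3) with hc
  have hcpos : 0 < c := lt_min hc₁pos (by positivity)
  refine ⟨c, 12, hcpos, ?_, 1, 10, ε₀, one_pos, by norm_num, hε₀pos, ?_⟩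
  · intro n ε hn hε hε1 T hT
    have hn1 : (1 : ℝ) ≤ n := by exact_mod_cast hn
    have hlogε : 0 ≤ Real.log (1 / ε) := Real.log_nonneg (by rw [le_div_iff₀ hε]; linarith)
    -- for `n < 1 / ε` the problem is at least as hard as with the larger gap `1 / n`
    set ε' := max ε (1 / n) with hε'
    have hε'pos : 0 < ε' := lt_of_lt_of_le hε (le_max_left _ _)
    have hmin : min ((n : ℝ) ^ 2) (1 / ε ^ 2) ≤ 1 / ε' ^ 2 := by
      rcases max_cases ε (1 / (n : ℝ)) with ⟨h, -⟩ | ⟨h, -⟩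
      · rw [hε', h]
        exact min_le_right _ _
      · rw [hε', h]
        refine (min_le_left _ _).trans_eq ?_
        field_simp
    rcases lt_or_ge ε' ε₀ with h | h
    · have hnε' : 1 / ε' ≤ (n : ℝ) := by
        rw [div_le_iff₀ hε'pos]
        have : 1 / (n : ℝ) ≤ ε' := le_max_right _ _
        rwa [div_le_iff₀' (by linarith)] at this
      obtain ⟨m, k, r, hm, -, -, hfit, hlong, htwo, hquery⟩ :=
        exists_hard_block_instances.{u} hε'pos (hlog ε' hε'pos h) hnε'
      have : Nonempty (Placement k r n (Fin (2 * m + 1))) :=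
        nonempty_placement (by simpa using hfit)
      have : Nonempty (Placement k r n (Fin m ⊕ Fin (m + 1))) :=
        nonempty_placement (by simpa [two_mul, add_assoc] using hfit)
      have hE := hquery T (hT.distinguishes hlong fun e =>
        ⟨(htwo e).1, (htwo e).2.1, (htwo e).2.2.mono (le_max_left _ _)⟩)
      refine le_trans ?_ hE
      have hlog' : 0 ≤ Real.log (1 / ε') := le_trans (by norm_num) (hlog ε' hε'pos h)
      have hlogle : Real.log (1 / ε') ≤ Real.log (1 / ε) :=
        Real.log_le_log (by positivity) (one_div_le_one_div_of_le hε (le_max_left _ _))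
      have hcc : c ≤ c₁ := min_le_left _ _
      gcongr
    · refine le_trans ?_ (hT.one_third_le hε1)
      have h1 : c * min ((n : ℝ) ^ 2) (1 / ε ^ 2) ≤ (ε₀ ^ 2 / 3) * (1 / ε₀ ^ 2) := by
        refine mul_le_mul (min_le_right _ _) (hmin.trans ?_) (by positivity) (by positivity)
        exact one_div_le_one_div_of_le (by positivity) (pow_le_pow_left₀ hε₀pos.le h 2)
      have h2 : (ε₀ ^ 2 / 3) * (1 / ε₀ ^ 2) = 1 / 3 := by field_simp
      rw [h2] at h1
      refine le_trans (div_le_self (by positivity) ?_) h1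
      exact one_le_pow₀ (by linarith)
  · intro n ε hε hlt hn
    obtain ⟨m, k, r, hm, ha, hb, hfit, hlong, htwo, hquery⟩ :=
      exists_hard_block_instances.{u} hε (hlog ε hε hlt) hn
    refine ⟨m, k, r, hm, ha, hb, hfit, hlong, htwo, fun T hT => le_trans ?_ (hquery T hT)⟩
    have hlog0 : 0 ≤ Real.log (1 / ε) := le_trans (by norm_num) (hlog ε hε hlt)
    have hcc : c ≤ c₁ := min_le_left _ _
    gcongr
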